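/- **Setting.** Let $\Omega$ and $A$ be finite sets (states, receiver actions), let $u,v:A\times\Omega\to[0,1]$ be the utilities of the designer and of the receiver, and let $\mu^*\in\Delta(\Omega)$ be a prior. In each period $t=1,\dots,T$ the designer announces a signaling scheme $\pi^{(t)}:\Omega\to\Delta(S)$, where $S$ is a finite signal set containing $A$; $\pi^{(t)}$ may depend only on the past schemes, signals and actions. A state $\omega^{(t)}\sim\mu^*$ is drawn independently, a signal $s^{(t)}\sim\pi^{(t)}(\cdot\mid\omega^{(t)})$ is sent, and the receiver takes an action $a^{(t)}\in\arg\max_a\sum_\omega\mu^*(\omega)\pi^{(t)}(s^{(t)}\mid\omega)v(a,\omega)$, ties being broken arbitrarily. With $U^*$ the maximal expected designer utility of a scheme in a single period under optimal receiver behavior, the regret is $\mathrm{Reg}(T)=T\,U^*-\mathbb E\big[\sum_{t=1}^T u(a^{(t)},\omega^{(t)})\big]$. **Assumptions.** (1) $\mu^*(\omega)\ge p_0>0$ for all $\omega$. (2) No action is weakly dominated: for no $a$ is there a mixture of the other actions that is at least as good as $a$ in every state. (3) In each state $\omega$ there is an action $a_\omega$ with $v(a_\omega,\omega)-v(a',\omega)>G>0$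 for all $a'\ne a_\omega$. (4) Some two states $\sigma,\sigma'$ have $a_{\sigma}\ne a_{\sigma'}$. The designer knows $u,v,p_0,G,D,T$, with $D$ as in the theorem, but not $\mu^*$. **Algorithm with accuracy $\varepsilon>0$.** *Search on $(\omega,\omega')$, where $a_\omega\ne a_{\omega'}$.* Start with $\ell=0$, $r=1/(Gp_0)$, $\tilde a=a_{\omega'}$. While $r-\ell>\varepsilon G$: put $q=(\ell+r)/2$; repeat a scheme $\pi$ with $\pi(s_0\mid\omega)=\min\{1,1/q\}$, $\pi(s_0\mid\omega')=\min\{q,1\}$ and $\pi(s_0\mid\cdot)=0$ in all other states (the other signals being arbitrary) until the signal $s_0$ is sent; if the receiver then takes $a_\omega$, set $\ell=q$; if he takes $a\neq a_\omega$, set $r=q$ and $\tilde a=a$. Output $\ell\,\frac{v(\tilde a,\omega')-v(a_\omega,\omega')}{v(a_\omega,\omega)-v(\tilde a,\omega)}$ as an estimate of $\mu^*(\omega)/\mu^*(\omega')$. *Pairs.* For any $\omega,\omega'$: if $a_\omega\ne a_{\omega'}$, search on $(\omega,\omega')$; otherwise pick $\kappa\in\{\sigma,\sigma'\}$ with $a_\kappa\ne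 a_\omega$, search on $(\omega,\kappa)$ and on $(\omega',\kappa)$, and divide the two outputs. *Full algorithm.* Fix an enumeration $\omega_1,\dots,\omega_{|\Omega|}$ of $\Omega$. Estimate, one after the other, $\hat\rho_{i}\approx\mu^*(\omega_i)/\mu^*(\omega_1)$ for $i=2,\dots,|\Omega|$; put $\hat\mu(\omega_1)=1/(1+\sum_{i\ge2}\hat\rho_i)$ and $\hat\mu(\omega_i)=\hat\rho_i\hat\mu(\omega_1)$. In all remaining periods use a robustification $\tilde\pi$ of an optimal persuasive direct scheme $\hat\pi:\Omega\to\Delta(A)$ for $\hat\mu$. It is built with the parameter $\varepsilon'=6|\Omega|\varepsilon/p_0^3$ as follows: let $\delta=2\varepsilon'/(p_0D)$, let $\eta_a\in\Delta(\Omega)$ be a belief on which $a$ beats every other action by at least $D$, let $P(a)=\sum_\omega\hat\mu(\omega)\hat\pi(a\mid\omega)$, let $\hat\mu_a$ be the posterior of $\hat\mu$ given recommendation $a$, and let $\xi_a=(1-\delta)\hat\mu_a+\delta\eta_a$; write $\hat\mu=(1-y)\sum_aP(a)\xi_a+y\chi$ with $\chi\in\Delta(\Omega)$ and $0\le y\le\delta/p_0$;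 and put $\tilde\pi(a\mid\omega)=\big((1-y)P(a)\xi_a(\omega)+\mathbf 1[a=a_\omega]\,y\chi(\omega)\big)/\hat\mu(\omega)$. **Theorem.** Under assumptions (1)–(4) there is a number $D>0$ such that for every action $a$ some belief $\eta_a\in\Delta(\Omega)$ satisfies $\mathbb E_{\eta_a}[v(a,\cdot)]\ge\mathbb E_{\eta_a}[v(a',\cdot)]+D$ for all $a'\ne a$. Let $D$ be any such number, and for $T\ge1$ put $\varepsilon=\frac{p_0^5D}{42|\Omega|T}$ and $L_T=\log_2\frac{42|\Omega|T}{G^2p_0^6D}$. Then, whatever choices are made where the algorithm leaves them open, and however ties are broken, the algorithm with accuracy $\varepsilon$ has $$\mathrm{Reg}(T)\le\frac{2|\Omega|}{p_0}\,\lceil L_T\rceil+2 .$$ If $2|\Omega|-3\le 3L_T$ (in particular, for all sufficiently large $T$), then moreover $$\mathrm{Reg}(T)\le\frac{2|\Omega|}{p_0}\,L_T+2=\frac{2|\Omega|}{p_0}\log_2\frac{42|\Omega|T}{G^2p_0^6D}+2 .$$ Hence $\mathrm{Reg}(T)=O(\log T)$: there is a constant $C$, independent of $T$, with $\mathrm{Reg}(T)\le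 C\log T$ for all $T\ge2$. -/

import Mathlib

noncomputable section

namespace Persuasion

/-- A signaling scheme `π : Ω → Δ(S)`: `π.prob ω s` is the probability `π(s | ω)`. -/
structure Scheme (Ω S : Type*) [Fintype S] where
  prob : Ω → S → ℝ
  nonneg : ∀ ω s, 0 ≤ prob ω s
  sum_one : ∀ ω, ∑ s, prob ω s = 1

section Static

variable {Ω A S : Type*} [Fintype Ω] [Fintype A] [Fintype S]

/-- Action `a` is optimal for a receiver with prior `μ` who observes signal `s` from `π`. -/
def IsBestResponse (v : A → Ω → ℝ) (μ : Ω → ℝ) (π : Scheme Ω S) (s : S) (a : A) : Prop :=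
  ∀ a' : A, ∑ ω, μ ω * π.prob ω s * v a' ω ≤ ∑ ω, μ ω * π.prob ω s * v a ω

/-- The designer's expected utility when signal `s` of `π` is answered by the action `α s`. -/
def utility (u : A → Ω → ℝ) (μ : Ω → ℝ) (π : Scheme Ω S) (α : S → A) : ℝ :=
  ∑ ω, μ ω * ∑ s, π.prob ω s * u (α s) ω

/-- `U*`: the largest utility of a signaling scheme with signal set `S` when the receiver best
responds (among optimal actions, the one that the designer prefers). -/
def optUtility (S : Type*) [Fintype S] (u v : A → Ω → ℝ) (μ : Ω → ℝ) : ℝ :=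
  sSup {x : ℝ | ∃ (π : Scheme Ω S) (α : S → A),
    (∀ s, IsBestResponse v μ π s (α s)) ∧ x = utility u μ π α}

/-- A direct scheme is persuasive for `μ` if every recommended action is optimal. -/
def IsPersuasive (v : A → Ω → ℝ) (μ : Ω → ℝ) (π : Scheme Ω A) : Prop :=
  ∀ a a' : A, 0 ≤ ∑ ω, μ ω * π.prob ω a * (v a ω - v a' ω)

/-- A direct scheme that is persuasive for `μ` and maximizes the designer's utility among the
persuasive direct schemes. -/
def IsOptimalDirect (u v : A → Ω → ℝ) (μ : Ω → ℝ) (π : Scheme Ω A) : Prop :=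
  IsPersuasive v μ π ∧
    ∀ π' : Scheme Ω A, IsPersuasive v μ π' → utility u μ π' id ≤ utility u μ π id

/-- No action is weakly dominated: no mixture of the other actions is at least as good in every
state. -/
def NoWeaklyDominatedAction (v : A → Ω → ℝ) : Prop :=
  ∀ a : A, ¬ ∃ α ∈ stdSimplex ℝ A, α a = 0 ∧ ∀ ω, v a ω ≤ ∑ a', α a' * v a' ω

/-- On the belief `η`, action `a` is better than every other action by a margin `D`. -/
def BeatsByMargin (v : A → Ω → ℝ) (D : ℝ) (η : Ω → ℝ) (a : A) : Prop :=
  ∀ a' : A, a' ≠ a → ∑ ω, η ω * v a' ω + D ≤ ∑ ω, η ω * v a ω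

/-- Every action is, on some belief, better than every other action by a margin `D > 0`. -/
def IsDominanceMargin (v : A → Ω → ℝ) (D : ℝ) : Prop :=
  0 < D ∧ ∀ a : A, ∃ η ∈ stdSimplex ℝ Ω, BeatsByMargin v D η a

/-- In each state one action is better than every other action by more than `G > 0`. -/
def HasUniqueOptimalActions (v : A → Ω → ℝ) (G : ℝ) : Prop :=
  0 < G ∧ ∀ ω : Ω, ∃ a : A, ∀ a' : A, a' ≠ a → G < v a ω - v a' ω

/-- A receiver-optimal action in state `ω`. -/
def optAct [Nonempty A] (v : A → Ω → ℝ) (ω : Ω) : A :=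
  Classical.choose (Finite.exists_max fun a => v a ω)

/-- Two states are distinguishable if their receiver-optimal actions differ. -/
def Distinguishable [Nonempty A] (v : A → Ω → ℝ) (ω ω' : Ω) : Prop :=
  optAct v ω ≠ optAct v ω'

/-- `π'` results from the direct scheme `π` by robustification around the prior `μ` with
parameter `e`. With `δ = 2 e / (p₀ D)`: the belief induced by recommendation `a` is tilted to
`ξ_a = (1 - δ) μ_a + δ η_a`, where `μ_a` is its posterior under `μ` and `η_a` is a belief on which
`a` is better by the margin `D`; then `μ = (1 - y) ∑ a, P(a) ξ_a + y χ`, where `P(a)` is the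
probability of recommendation `a`; with the probability `y χ(ω)` left over, the state `ω` is
revealed, and the signal that reveals `ω` is merged into the recommendation of its optimal action.
Here `w a ω = P(a) ξ_a(ω)`. -/
def IsRobustification [Nonempty A] [DecidableEq A] (v : A → Ω → ℝ) (p₀ D e : ℝ)
    (μ : Ω → ℝ) (π π' : Scheme Ω A) : Prop :=
  ∃ (δ y : ℝ) (η w : A → Ω → ℝ) (χ : Ω → ℝ),
    δ = 2 * e / (p₀ * D) ∧
    (∀ a, η a ∈ stdSimplex ℝ Ω ∧ BeatsByMargin v D (η a) a) ∧
    (∀ a ω, w a ω =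
      (1 - δ) * (μ ω * π.prob ω a) + δ * ((∑ ω', μ ω' * π.prob ω' a) * η a ω)) ∧
    0 ≤ y ∧ y ≤ δ / p₀ ∧ χ ∈ stdSimplex ℝ Ω ∧
    (∀ ω, μ ω = (1 - y) * ∑ a, w a ω + y * χ ω) ∧
    ∀ ω a, π'.prob ω a =
      ((1 - y) * w a ω + if a = optAct v ω then y * χ ω else 0) / μ ω

/-- `π'` is a robustification of an optimal direct scheme for `μ`. -/
def IsRobustOptimal [Nonempty A] [DecidableEq A] (u v : A → Ω → ℝ) (p₀ D e : ℝ)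
    (μ : Ω → ℝ) (π' : Scheme Ω A) : Prop :=
  ∃ π : Scheme Ω A, IsOptimalDirect u v μ π ∧ IsRobustification v p₀ D e μ π π'

/-- A direct scheme, announced with the signal set `S`: recommendation `a` is the signal `ι a`. -/
def Scheme.embed [DecidableEq S] (ι : A ↪ S) (π : Scheme Ω A) : Scheme Ω S where
  prob ω s := ∑ a, if ι a = s then π.prob ω a else 0
  nonneg ω s := Finset.sum_nonneg fun a _ => by
    split_ifs
    · exact π.nonneg ω a
    · exact le_rfl
  sum_one ω := by
    rw [Finset.sum_comm]
    simpa using π.sum_one ω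

end Static

section Dynamic

variable {Ω A S : Type*} [Fintype Ω] [Fintype A] [Fintype S]

/-- What the designer has observed: the signals and actions of the past periods, oldest first. -/
abbrev History (A S : Type*) := List (S × A)

/-- A learning algorithm of the designer: the scheme announced after each history. -/
abbrev Strategy (Ω A S : Type*) [Fintype S] := History A S → Scheme Ω S

/-- The behavior of the receivers: the action taken after each history, scheme and signal. -/
abbrev Behavior (Ω A S : Type*) [Fintype S] := History A S → Scheme Ω S → S → A

/-- The receivers always take an optimal action; ties are broken in an arbitrary way, which may
depend on the past. -/
def IsOptimalBehavior (v : A → Ω → ℝ) (μ : Ω → ℝ) (R : Behavior Ω A S) : Prop :=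
  ∀ h π s, IsBestResponse v μ π s (R h π s)

/-- The expected total utility `E[∑ t ≤ n, u(a_t, ω_t)]` of the designer over `n` periods. In the
first of them the scheme is `σ []`, the state is drawn from `μ` and the signal `s` from the scheme,
and the receiver answers with `R [] (σ []) s`; this pair then heads all later histories. -/
def expectedTotal (u : A → Ω → ℝ) (μ : Ω → ℝ) : ℕ → Strategy Ω A S → Behavior Ω A S → ℝ
  | 0, _, _ => 0
  | n + 1, σ, R => ∑ ω, μ ω * ∑ s, (σ []).prob ω s *
      (u (R [] (σ []) s) ω +
        expectedTotal u μ n (fun h => σ ((s, R [] (σ []) s) :: h))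
          (fun h => R ((s, R [] (σ []) s) :: h)))

/-- The regret over `T` periods. -/
def regret (u v : A → Ω → ℝ) (μ : Ω → ℝ) (T : ℕ) (σ : Strategy Ω A S) (R : Behavior Ω A S) : ℝ :=
  T * optUtility S u v μ - expectedTotal u μ T σ R

/-- The choices that the learning algorithm leaves open. -/
structure Choices (Ω A S : Type*) [Fintype A] [Fintype S] where
  /-- the state `ω₁` with which all other states are compared -/
  ref : Ω
  /-- the other states, in the order in which they are treated -/
  others : List Ω
  /-- a distinguishable pair of states -/
  d₁ : Ω
  /-- a distinguishable pair of states -/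
  d₂ : Ω
  /-- the signal `s₀` used to test the signaling ratio `q` on a pair of states -/
  sig : Ω → Ω → ℝ → S
  /-- the scheme used to test the signaling ratio `q` on a pair of states -/
  probe : Ω → Ω → ℝ → Scheme Ω S
  /-- the direct scheme used once the prior is estimated, as a function of the estimate -/
  exploit : (Ω → ℝ) → Scheme Ω A

/-- The requirements of the algorithm, run with accuracy `ε`, on its choices. -/
structure Choices.Valid [Nonempty A] [DecidableEq A] (u v : A → Ω → ℝ) (p₀ D ε : ℝ)
    (c : Choices Ω A S) : Prop where
  nodup : (c.ref :: c.others).Nodup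
  complete : ∀ ω, ω ∈ c.ref :: c.others
  dist : Distinguishable v c.d₁ c.d₂
  /-- `s₀` is sent with probability `1` in one of the two states, the ratio of its probabilities is
  `q`, and it is never sent in a third state; the other signals are unrestricted -/
  probe_spec : ∀ (ω₁ ω₂ : Ω) (q : ℝ), ω₁ ≠ ω₂ → 0 < q →
    (c.probe ω₁ ω₂ q).prob ω₁ (c.sig ω₁ ω₂ q) = min 1 (1 / q) ∧
    (c.probe ω₁ ω₂ q).prob ω₂ (c.sig ω₁ ω₂ q) = min q 1 ∧
    ∀ ω, ω ≠ ω₁ → ω ≠ ω₂ → (c.probe ω₁ ω₂ q).prob ω (c.sig ω₁ ω₂ q) = 0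
  /-- wherever a robustified optimal scheme exists, one is used -/
  exploit_spec : ∀ μ : Ω → ℝ,
    (∃ π, IsRobustOptimal u v p₀ D (6 * Fintype.card Ω * ε / p₀ ^ 3) μ π) →
      IsRobustOptimal u v p₀ D (6 * Fintype.card Ω * ε / p₀ ^ 3) μ (c.exploit μ)

variable [Nonempty A] [DecidableEq A] [DecidableEq S]

/-- Binary search for `μ(ω₁) / μ(ω₂)`, from the interval `[l, r]` and the alternative action `b` on;
the strategy continues with `k ρ` once the estimate `ρ` is found. The current scheme is repeated
until the test signal is sent. -/
def searchFrom (v : A → Ω → ℝ) (G ε : ℝ) (c : Choices Ω A S) (ω₁ ω₂ : Ω)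
    (k : ℝ → Strategy Ω A S) (l r : ℝ) (b : A) : Strategy Ω A S := fun h =>
  if r - l ≤ ε * G then
    k (l * ((v b ω₂ - v (optAct v ω₁) ω₂) / (v (optAct v ω₁) ω₁ - v b ω₁))) h
  else
    match h with
    | [] => c.probe ω₁ ω₂ ((l + r) / 2)
    | (s, a) :: h' =>
      if s = c.sig ω₁ ω₂ ((l + r) / 2) then
        if a = optAct v ω₁ then searchFrom v G ε c ω₁ ω₂ k ((l + r) / 2) r b h'
        else searchFrom v G ε c ω₁ ω₂ k l ((l + r) / 2) a h'
      else searchFrom v G ε c ω₁ ω₂ k l r b h'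

/-- Estimating the prior ratio `μ(ω₁) / μ(ω₂)` of two distinguishable states. -/
def search (v : A → Ω → ℝ) (p₀ G ε : ℝ) (c : Choices Ω A S) (ω₁ ω₂ : Ω)
    (k : ℝ → Strategy Ω A S) : Strategy Ω A S :=
  searchFrom v G ε c ω₁ ω₂ k 0 (1 / (G * p₀)) (optAct v ω₂)

open Classical in
/-- Estimating the prior ratio `μ(i) / μ(j)` of any two states. -/
def pairEstimate (v : A → Ω → ℝ) (p₀ G ε : ℝ) (c : Choices Ω A S) (i j : Ω)
    (k : ℝ → Strategy Ω A S) : Strategy Ω A S :=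
  if Distinguishable v i j then search v p₀ G ε c i j k
  else
    let m := if Distinguishable v c.d₁ i then c.d₁ else c.d₂
    search v p₀ G ε c i m fun x => search v p₀ G ε c j m fun y => k (x / y)

/-- Estimating the ratios `μ(i) / μ(ref)` for all states `i` of a list, one after the other. -/
def estimateAll [DecidableEq Ω] (v : A → Ω → ℝ) (p₀ G ε : ℝ) (c : Choices Ω A S)
    (k : (Ω → ℝ) → Strategy Ω A S) : List Ω → (Ω → ℝ) → Strategy Ω A S
  | [], ρ => k ρ
  | i :: is, ρ => pairEstimate v p₀ G ε c i c.ref fun x =>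
      estimateAll v p₀ G ε c k is (Function.update ρ i x)

/-- The estimated prior, from the estimated ratios `ρ i` of `μ(i)` to `μ(ref)`. -/
def priorEstimate [DecidableEq Ω] (ref : Ω) (ρ : Ω → ℝ) (ω : Ω) : ℝ :=
  if ω = ref then 1 / (1 + ∑ i ∈ Finset.univ.erase ref, ρ i)
  else ρ ω * (1 / (1 + ∑ i ∈ Finset.univ.erase ref, ρ i))

/-- The learning algorithm with accuracy `ε`: estimate all ratios, form the estimated prior, and
use a robustified optimal scheme for it in all remaining periods. -/
def learnAndRobustify [DecidableEq Ω] (ι : A ↪ S) (v : A → Ω → ℝ) (p₀ G ε : ℝ)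
    (c : Choices Ω A S) : Strategy Ω A S :=
  estimateAll v p₀ G ε c
    (fun ρ _ => (c.exploit (priorEstimate c.ref ρ)).embed ι) c.others (fun _ => 0)

end Dynamic

/-- The accuracy `ε = p₀⁵ D / (42 |Ω| T)`. -/
def accuracy (Ω : Type*) [Fintype Ω] (p₀ D : ℝ) (T : ℕ) : ℝ :=
  p₀ ^ 5 * D / (42 * Fintype.card Ω * T)

/-- `log₂ (42 |Ω| T / (G² p₀⁶ D))`. -/
def logTerm (Ω : Type*) [Fintype Ω] (p₀ G D : ℝ) (T : ℕ) : ℝ :=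
  Real.logb 2 (42 * Fintype.card Ω * T / (G ^ 2 * p₀ ^ 6 * D))

end Persuasion

end

noncomputable section

namespace Persuasion

set_option linter.unusedSectionVars false

/-! ### Beliefs that favour one action, direct schemes, and robustification. -/

section Static

variable {Ω A S : Type*} [Fintype Ω] [Fintype A] [Fintype S]

/-! Two costs are separated: learning the prior, at most 1 per period, and exploiting the estimate,
`O(1/T)` per period.

Learning. When the test signal occurs only in `ω₁` and `ω₂`, with probability ratio `q`, the answer
shows whether `q` is below or above an indifference ratio, and this ratio determines `μ ω₁ / μ ω₂`.
Each answer halves the search interval, and the test signal has probability at least `p₀`, so a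
halving costs at most `1 / p₀` periods in expectation. This is a potential argument: `j / p₀` pays
for `j` outstanding halvings (`SearchInvariant`, `loss_searchFrom_le`). Comparing a state with the
reference state takes at most two searches, and for at least one state a single search suffices,
which gives at most `2|Ω| - 3` searches (`sum_numSearches_add_three_le`).

Exploiting. Tilting every posterior slightly towards a belief where the recommended action wins by
`D` makes all recommendations that are sent strictly optimal under every nearby prior, so
tie-breaking is harmless (`IsRobustification.eq_zero_or_pos`). To compare with the optimum for `μ`,
robustify a competitor around `μ`: it is then persuasive for the estimate, hence no better there
than the scheme optimal for the estimate, whose own robustification is obeyed under `μ`. Two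
robustifications and two changes of prior are paid for (`optUtility_le_of_isRobustOptimal`), in
total at most 2 over `T` periods. -/

theorem exists_belief_of_not_dominated [Nontrivial A] {v : A → Ω → ℝ}
    (hdom : NoWeaklyDominatedAction v) (a : A) :
    ∃ D : ℝ, 0 < D ∧ ∃ η ∈ stdSimplex ℝ Ω, BeatsByMargin v D η a := by
  classical
  let M : (A → ℝ) →ₗ[ℝ] (Ω → ℝ) :=
    { toFun := fun α ω => ∑ b, α b * v b ω
      map_add' := fun α β => by
        ext ω; simp [add_mul, Finset.sum_add_distrib]
      map_smul' := fun c α => by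
        ext ω; simp [Finset.mul_sum, mul_assoc] }
  have hMc : Continuous M := M.continuous_of_finiteDimensional
  -- Payoff vectors of mixtures without `a` form a compact convex set. Non-domination says that it
  -- misses the closed orthant above `v a`, so a functional separates the two with a gap `t - s`;
  -- normalized, it is the belief.
  let K : Set (A → ℝ) := stdSimplex ℝ A ∩ {α | α a = 0}
  have hK : IsCompact K :=
    (isCompact_stdSimplex ℝ A).inter_right (isClosed_eq (continuous_apply a) continuous_const)
  have hKc : Convex ℝ K := (convex_stdSimplex ℝ A).inter
    (convex_hyperplane (𝕜 := ℝ) (f := fun α : A → ℝ => α a)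
      ⟨fun _ _ => rfl, fun _ _ => rfl⟩ 0)
  have hdisj : Disjoint (M '' K) (Set.Ici (v a)) := by
    rw [Set.disjoint_left]
    rintro _ ⟨α, ⟨hα, h0⟩, rfl⟩ hle
    exact hdom a ⟨α, hα, h0, fun ω => hle ω⟩
  obtain ⟨f, s, t, hs, hst, ht⟩ := geometric_hahn_banach_compact_closed
    (hKc.linear_image M) (hK.image hMc) (convex_Ici (v a)) isClosed_Ici hdisj
  have hf : ∀ x : Ω → ℝ, f x = ∑ ω, f (Pi.single ω 1) * x ω := by
    intro x
    conv_lhs => rw [← Finset.univ_sum_single x]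
    rw [map_sum]
    refine Finset.sum_congr rfl fun ω _ => ?_
    have : (Pi.single ω (x ω) : Ω → ℝ) = x ω • Pi.single ω 1 := by
      rw [← Pi.single_smul]; simp
    rw [this, map_smul, smul_eq_mul, mul_comm]
  have hact : ∀ b, b ≠ a → f (v b) < s := by
    intro b hb
    refine hs _ ⟨Pi.single b 1, ⟨single_mem_stdSimplex ℝ b, ?_⟩, ?_⟩
    · simp [hb.symm]
    · ext ω
      simp [M, Pi.single_apply]
  have ha : t < f (v a) := ht _ Set.self_mem_Ici
  -- The orthant is unbounded upwards, so a negative coefficient would push `f` down to the level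
  -- `t` inside it.
  have hnn : ∀ ω, 0 ≤ f (Pi.single ω 1) := by
    intro ω
    by_contra! hneg
    set g := f (Pi.single ω 1) with hg
    have hc : 0 ≤ (f (v a) - t) / (-g) := div_nonneg (by linarith) (by linarith)
    have := ht (v a + ((f (v a) - t) / (-g)) • Pi.single ω 1) (by
      intro ω'
      by_cases h : ω' = ω
      · subst h; simpa using hc
      · simp [h])
    rw [map_add, map_smul, smul_eq_mul, ← hg] at this
    have hne : g ≠ 0 := hneg.ne
    have : (f (v a) - t) / (-g) * g = -(f (v a) - t) := by field_simp
    linarith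
  obtain ⟨b, hb⟩ := exists_ne a
  -- A second action `b` rules out `f = 0`, which would give both `0 < s` and `t < 0`.
  have hpos : 0 < ∑ ω, f (Pi.single ω 1) := by
    refine lt_of_le_of_ne (Finset.sum_nonneg fun ω _ => hnn ω) fun h0 => ?_
    have hz := (Finset.sum_eq_zero_iff_of_nonneg fun ω _ => hnn ω).1 h0.symm
    have hz' : ∀ x, f x = 0 := fun x => by
      rw [hf]; exact Finset.sum_eq_zero fun ω hω => by rw [hz ω hω, zero_mul]
    have := hact b hb
    rw [hz'] at this ha
    linarith
  set Z := ∑ ω, f (Pi.single ω 1) with hZ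
  refine ⟨(t - s) / Z, div_pos (by linarith) hpos, fun ω => f (Pi.single ω 1) / Z,
    ⟨fun ω => div_nonneg (hnn ω) hpos.le, ?_⟩, fun b hb => ?_⟩
  · rw [← Finset.sum_div, ← hZ, div_self hpos.ne']
  · have key : ∀ x : Ω → ℝ, ∑ ω, f (Pi.single ω 1) / Z * x ω = f x / Z := fun x => by
      rw [hf x, Finset.sum_div]
      exact Finset.sum_congr rfl fun ω _ => by ring
    rw [key, key, ← add_div]
    have := hact b hb
    gcongr
    linarith

theorem exists_dominanceMargin [Nontrivial A] {v : A → Ω → ℝ}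
    (hdom : NoWeaklyDominatedAction v) : ∃ D : ℝ, IsDominanceMargin v D := by
  choose D hD η hη hb using exists_belief_of_not_dominated hdom
  obtain ⟨a₀, h₀⟩ := Finite.exists_min D
  refine ⟨D a₀, hD a₀, fun a => ⟨η a, hη a, fun b hba => ?_⟩⟩
  have := hb a b hba
  linarith [h₀ a]

theorem IsDominanceMargin.le_one [Nontrivial A] {v : A → Ω → ℝ} {D : ℝ}
    (hD : IsDominanceMargin v D) (hv : ∀ a ω, v a ω ∈ Set.Icc (0 : ℝ) 1) : D ≤ 1 := by
  obtain ⟨a, b, hab⟩ := exists_pair_ne A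
  obtain ⟨η, hη, hb⟩ := hD.2 a
  have h1 := hb b hab.symm
  have h2 : 0 ≤ ∑ ω, η ω * v b ω :=
    Finset.sum_nonneg fun ω _ => mul_nonneg (hη.1 ω) (hv b ω).1
  have h3 : ∑ ω, η ω * v a ω ≤ ∑ ω, η ω :=
    Finset.sum_le_sum fun ω _ => mul_le_of_le_one_right (hη.1 ω) (hv a ω).2
  rw [hη.2] at h3
  linarith

theorem le_optAct [Nonempty A] (v : A → Ω → ℝ) (ω : Ω) (a : A) : v a ω ≤ v (optAct v ω) ω :=
  Classical.choose_spec (Finite.exists_max fun a => v a ω) a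

theorem HasUniqueOptimalActions.gap [Nonempty A] {v : A → Ω → ℝ} {G : ℝ}
    (hG : HasUniqueOptimalActions v G) {ω : Ω} {a : A} (ha : a ≠ optAct v ω) :
    G < v (optAct v ω) ω - v a ω := by
  obtain ⟨b, hb⟩ := hG.2 ω
  by_cases h : optAct v ω = b
  · rw [h] at ha ⊢
    exact hb a ha
  · have := hb _ h
    linarith [hG.1, le_optAct v ω b]

theorem utility_nonneg {u : A → Ω → ℝ} (hu : ∀ a ω, u a ω ∈ Set.Icc (0 : ℝ) 1) {μ : Ω → ℝ}
    (hμ : ∀ ω, 0 ≤ μ ω) (π : Scheme Ω S) (α : S → A) : 0 ≤ utility u μ π α :=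
  Finset.sum_nonneg fun ω _ => mul_nonneg (hμ ω) <| Finset.sum_nonneg fun s _ =>
    mul_nonneg (π.nonneg ω s) (hu _ _).1

theorem sum_prob_mul_mem_Icc {u : A → Ω → ℝ} (hu : ∀ a ω, u a ω ∈ Set.Icc (0 : ℝ) 1)
    (π : Scheme Ω S) (α : S → A) (ω : Ω) :
    ∑ s, π.prob ω s * u (α s) ω ∈ Set.Icc (0 : ℝ) 1 := by
  refine ⟨Finset.sum_nonneg fun s _ => mul_nonneg (π.nonneg ω s) (hu _ _).1, ?_⟩
  rw [← π.sum_one ω]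
  exact Finset.sum_le_sum fun s _ => mul_le_of_le_one_right (π.nonneg ω s) (hu _ _).2

theorem utility_le_one {u : A → Ω → ℝ} (hu : ∀ a ω, u a ω ∈ Set.Icc (0 : ℝ) 1) {μ : Ω → ℝ}
    (hμ : μ ∈ stdSimplex ℝ Ω) (π : Scheme Ω S) (α : S → A) : utility u μ π α ≤ 1 := by
  rw [← hμ.2]
  exact Finset.sum_le_sum fun ω _ =>
    mul_le_of_le_one_right (hμ.1 ω) (sum_prob_mul_mem_Icc hu π α ω).2

theorem utility_le_add_sum_abs {u : A → Ω → ℝ} (hu : ∀ a ω, u a ω ∈ Set.Icc (0 : ℝ) 1)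
    (μ ν : Ω → ℝ) (π : Scheme Ω S) (α : S → A) :
    utility u μ π α ≤ utility u ν π α + ∑ ω, |μ ω - ν ω| := by
  unfold utility
  rw [← Finset.sum_add_distrib]
  refine Finset.sum_le_sum fun ω _ => ?_
  obtain ⟨h0, h1⟩ := sum_prob_mul_mem_Icc hu π α ω
  have h2 := le_abs_self (μ ω - ν ω)
  have h3 := abs_nonneg (μ ω - ν ω)
  nlinarith

theorem optUtility_le_one {u v : A → Ω → ℝ} (hu : ∀ a ω, u a ω ∈ Set.Icc (0 : ℝ) 1) {μ : Ω → ℝ}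
    (hμ : μ ∈ stdSimplex ℝ Ω) : optUtility S u v μ ≤ 1 := by
  refine Real.sSup_le ?_ zero_le_one
  rintro x ⟨π, α, -, rfl⟩
  exact utility_le_one hu hμ π α

/-- The direct scheme that recommends the action `α s` instead of sending the signal `s`. -/
def Scheme.merge [DecidableEq A] (π : Scheme Ω S) (α : S → A) : Scheme Ω A where
  prob ω a := ∑ s, if α s = a then π.prob ω s else 0
  nonneg ω a := Finset.sum_nonneg fun s _ => by
    split_ifs
    · exact π.nonneg ω s
    · exact le_rfl
  sum_one ω := by
    rw [Finset.sum_comm]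
    simpa using π.sum_one ω

theorem Scheme.sum_merge_mul [DecidableEq A] (π : Scheme Ω S) (α : S → A) (ω : Ω) (f : A → ℝ) :
    ∑ a, (π.merge α).prob ω a * f a = ∑ s, π.prob ω s * f (α s) := by
  simp only [Scheme.merge, Finset.sum_mul]
  rw [Finset.sum_comm]
  simp [ite_mul]

/-- Revelation principle: optimality inequalities for signals with the same answer add up. This
reduces `optUtility` over an arbitrary signal set to direct schemes. -/
theorem isPersuasive_merge [DecidableEq A] {v : A → Ω → ℝ} {μ : Ω → ℝ} {π : Scheme Ω S}
    {α : S → A} (h : ∀ s, IsBestResponse v μ π s (α s)) : IsPersuasive v μ (π.merge α) := by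
  intro a b
  have : ∑ ω, μ ω * (π.merge α).prob ω a * (v a ω - v b ω) =
      ∑ s, if α s = a then ∑ ω, μ ω * π.prob ω s * (v a ω - v b ω) else 0 := by
    simp only [Scheme.merge, Finset.mul_sum, Finset.sum_mul]
    rw [Finset.sum_comm]
    refine Finset.sum_congr rfl fun s _ => ?_
    split_ifs <;> simp
  rw [this]
  refine Finset.sum_nonneg fun s _ => ?_
  split_ifs with hs
  · have := h s b
    rw [hs] at this
    simp only [mul_sub, Finset.sum_sub_distrib]
    linarith
  · exact le_rfl

theorem utility_merge [DecidableEq A] (u : A → Ω → ℝ) (μ : Ω → ℝ) (π : Scheme Ω S) (α : S → A) :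
    utility u μ (π.merge α) id = utility u μ π α := by
  unfold utility
  refine Finset.sum_congr rfl fun ω _ => ?_
  rw [← π.sum_merge_mul α ω fun a => u a ω]
  rfl

/-- The direct scheme that reveals the state and recommends its optimal action. -/
def fullRevelation [Nonempty A] [DecidableEq A] (v : A → Ω → ℝ) : Scheme Ω A where
  prob ω a := if a = optAct v ω then 1 else 0
  nonneg ω a := by split_ifs <;> norm_num
  sum_one ω := by simp

theorem isPersuasive_fullRevelation [Nonempty A] [DecidableEq A] (v : A → Ω → ℝ) {μ : Ω → ℝ}
    (hμ : ∀ ω, 0 ≤ μ ω) : IsPersuasive v μ (fullRevelation v) := by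
  intro a b
  refine Finset.sum_nonneg fun ω _ => ?_
  simp only [fullRevelation]
  split_ifs with h
  · subst h
    exact mul_nonneg (by simpa using hμ ω) (sub_nonneg.2 (le_optAct v ω b))
  · simp

/-- The persuasive direct schemes form a compact set, nonempty because of full revelation, and the
utility is continuous on it. -/
theorem exists_isOptimalDirect [Nonempty A] (u v : A → Ω → ℝ) {μ : Ω → ℝ}
    (hμ : ∀ ω, 0 ≤ μ ω) : ∃ π : Scheme Ω A, IsOptimalDirect u v μ π := by
  classical
  let K : Set (Ω → A → ℝ) := (Set.univ.pi fun _ => stdSimplex ℝ A) ∩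
    {p | ∀ a b : A, 0 ≤ ∑ ω, μ ω * p ω a * (v a ω - v b ω)}
  have hK : IsCompact K := by
    refine (isCompact_univ_pi fun _ => isCompact_stdSimplex ℝ A).inter_right ?_
    simp only [Set.ofPred_forall]
    refine isClosed_iInter fun a => isClosed_iInter fun b => isClosed_le continuous_const ?_
    fun_prop
  have mem : ∀ π : Scheme Ω A, IsPersuasive v μ π → π.prob ∈ K := fun π h =>
    ⟨fun ω _ => ⟨π.nonneg ω, π.sum_one ω⟩, h⟩
  obtain ⟨p, hp, hmax⟩ := hK.exists_isMaxOn
    ⟨_, mem _ (isPersuasive_fullRevelation v hμ)⟩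
    (f := fun p : Ω → A → ℝ => ∑ ω, μ ω * ∑ a, p ω a * u a ω) (by fun_prop)
  exact ⟨⟨p, fun ω => (hp.1 ω trivial).1, fun ω => (hp.1 ω trivial).2⟩, hp.2,
    fun π' h' => hmax (mem π' h')⟩

/-! ### Robustified schemes: existence, strict persuasiveness, utility loss. -/

variable [Nonempty A] [DecidableEq A]

/-- With the largest admissible weight `y = δ / p₀`, the residual `μ - (1 - y) ∑ w` is nonnegative
and defines `χ`. The bound on `μ` is weaker than `p₀ ≤ μ ω` because an estimated prior may fall
slightly below `p₀`. -/
theorem exists_isRobustification {v : A → Ω → ℝ} {p₀ D e : ℝ} (hp₀ : 0 < p₀) (hp₁ : p₀ ≤ 1)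
    (hD : IsDominanceMargin v D) (he : 0 < e) (hδ : 2 * e / (p₀ * D) ≤ p₀) {μ : Ω → ℝ}
    (hμ : ∑ ω, μ ω = 1) (hμp : ∀ ω, p₀ ≤ (1 + p₀) * μ ω) (π : Scheme Ω A) :
    ∃ π', IsRobustification v p₀ D e μ π π' := by
  have hpos : ∀ ω, 0 < μ ω := fun ω =>
    pos_of_mul_pos_right (hp₀.trans_le (hμp ω)) (by linarith)
  choose η hη hb using hD.2
  set δ := 2 * e / (p₀ * D) with hδd
  have hδ0 : 0 < δ := div_pos (by linarith) (mul_pos hp₀ hD.1)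
  set y := δ / p₀ with hy
  have hy0 : 0 < y := div_pos hδ0 hp₀
  have hy1 : y ≤ 1 := (div_le_one hp₀).2 hδ
  have hδy : δ = y * p₀ := by rw [hy]; field_simp
  set P : A → ℝ := fun a => ∑ ω, μ ω * π.prob ω a with hP
  have hP0 : ∀ a, 0 ≤ P a := fun a =>
    Finset.sum_nonneg fun ω _ => mul_nonneg (hpos ω).le (π.nonneg ω a)
  have hP1 : ∑ a, P a = 1 := by
    simp only [hP]
    rw [Finset.sum_comm]
    simp [← Finset.mul_sum, π.sum_one, hμ]
  set w : A → Ω → ℝ := fun a ω => (1 - δ) * (μ ω * π.prob ω a) + δ * (P a * η a ω) with hw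
  have hw0 : ∀ a ω, 0 ≤ w a ω := fun a ω => add_nonneg
    (mul_nonneg (by linarith) (mul_nonneg (hpos ω).le (π.nonneg ω a)))
    (mul_nonneg hδ0.le (mul_nonneg (hP0 a) ((hη a).1 ω)))
  have hwsum : ∀ ω, ∑ a, w a ω = (1 - δ) * μ ω + δ * ∑ a, P a * η a ω := fun ω => by
    simp only [hw, Finset.sum_add_distrib, ← Finset.mul_sum, π.sum_one, mul_one]
  have hη1 : ∀ ω, ∑ a, P a * η a ω ≤ 1 := fun ω => by
    rw [← hP1]
    refine Finset.sum_le_sum fun a _ => mul_le_of_le_one_right (hP0 a) ?_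
    rw [← (hη a).2]
    exact Finset.single_le_sum (fun ω _ => (hη a).1 ω) (Finset.mem_univ ω)
  have hwle : ∀ ω, (1 - y) * ∑ a, w a ω ≤ μ ω := fun ω => by
    rw [hwsum]
    -- Since `δ = y p₀`, the tilted mass is at most `(1 + y) μ ω`, and `(1 - y)(1 + y) ≤ 1`.
    have h1 : (1 - δ) * μ ω + δ * ∑ a, P a * η a ω ≤ (1 - δ) * μ ω + y * ((1 + p₀) * μ ω) := by
      have := mul_le_mul_of_nonneg_left (hη1 ω) hδ0.le
      have := mul_le_mul_of_nonneg_left (hμp ω) hy0.le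
      rw [hδy] at *
      linarith
    have h2 : (1 - δ) * μ ω + y * ((1 + p₀) * μ ω) = (1 + y) * μ ω := by rw [hδy]; ring
    have h3 := mul_le_mul_of_nonneg_left (h1.trans_eq h2) (sub_nonneg.2 hy1)
    have := mul_nonneg (sq_nonneg y) (hpos ω).le
    nlinarith
  have hwtot : ∑ ω, ∑ a, w a ω = 1 := by
    simp only [hwsum, Finset.sum_add_distrib, ← Finset.mul_sum, hμ]
    rw [Finset.sum_comm]
    simp only [← Finset.mul_sum, (hη _).2, mul_one, hP1]
    ring
  let χ : Ω → ℝ := fun ω => (μ ω - (1 - y) * ∑ a, w a ω) / y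
  have hχ0 : ∀ ω, 0 ≤ χ ω := fun ω => div_nonneg (sub_nonneg.2 (hwle ω)) hy0.le
  have hyχ : ∀ ω, y * χ ω = μ ω - (1 - y) * ∑ a, w a ω := fun ω => by
    simp only [χ]; field_simp
  refine ⟨⟨fun ω a => ((1 - y) * w a ω + if a = optAct v ω then y * χ ω else 0) / μ ω,
    fun ω a => div_nonneg (add_nonneg (mul_nonneg (by linarith) (hw0 a ω)) ?_) (hpos ω).le,
    fun ω => ?_⟩, δ, y, η, w, χ, rfl, fun a => ⟨hη a, hb a⟩, fun _ _ => rfl, hy0.le, le_rfl,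
    ⟨hχ0, ?_⟩, fun ω => by rw [hyχ]; ring, fun _ _ => rfl⟩
  · split_ifs
    · exact mul_nonneg hy0.le (hχ0 ω)
    · exact le_rfl
  · rw [← Finset.sum_div, Finset.sum_add_distrib, ← Finset.mul_sum]
    simp only [Finset.sum_ite_eq', Finset.mem_univ, if_true, hyχ]
    rw [add_sub_cancel, div_self (hpos ω).ne']
  · simp only [χ]
    rw [← Finset.sum_div, Finset.sum_sub_distrib, ← Finset.mul_sum, hwtot, hμ]
    field_simp
    ring

/-- Recommendations of a robustified scheme are strictly optimal under all close priors. -/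
theorem IsRobustification.eq_zero_or_pos {v : A → Ω → ℝ} {p₀ D e G : ℝ} (hp₀ : 0 < p₀)
    (hp₁ : p₀ ≤ 1) (hD : 0 < D) (he : 0 < e) (hδ : 2 * e / (p₀ * D) < p₀)
    (hv : ∀ a ω, v a ω ∈ Set.Icc (0 : ℝ) 1) (hG : HasUniqueOptimalActions v G) {μ ν : Ω → ℝ}
    (hμ : ∀ ω, 0 < μ ω) (hν : ∀ ω, 0 < ν ω) (hμν : ∀ ω, |ν ω - μ ω| * p₀ ≤ e * μ ω)
    {π π' : Scheme Ω A} (hπ : IsPersuasive v μ π) (h : IsRobustification v p₀ D e μ π π')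
    {a b : A} (hba : b ≠ a) :
    (∀ ω, π'.prob ω a = 0) ∨ 0 < ∑ ω, ν ω * π'.prob ω a * (v a ω - v b ω) := by
  obtain ⟨δ, y, η, w, χ, hδd, hη, hw, hy0, hy, hχ, -, hπ'⟩ := h
  rw [← hδd] at hδ
  have hδ0 : 0 < δ := by rw [hδd]; exact div_pos (by linarith) (mul_pos hp₀ hD)
  have hy1 : y < 1 := hy.trans_lt ((div_lt_one hp₀).2 hδ)
  have hδD : δ * D = 2 * (e / p₀) := by rw [hδd]; field_simp
  set P := ∑ ω, μ ω * π.prob ω a with hP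
  have hP0 : 0 ≤ P := Finset.sum_nonneg fun ω _ => mul_nonneg (hμ ω).le (π.nonneg ω a)
  have hw0 : ∀ ω, 0 ≤ w a ω := fun ω => by
    rw [hw]
    exact add_nonneg (mul_nonneg (by linarith) (mul_nonneg (hμ ω).le (π.nonneg ω a)))
      (mul_nonneg hδ0.le (mul_nonneg hP0 ((hη a).1.1 ω)))
  have hwP : ∑ ω, w a ω = P := by
    simp only [hw, Finset.sum_add_distrib, ← Finset.mul_sum, (hη a).1.2, ← hP]
    ring
  have hwv : 2 * (e / p₀) * P ≤ ∑ ω, w a ω * (v a ω - v b ω) := by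
    have e1 : ∑ ω, w a ω * (v a ω - v b ω) =
        (1 - δ) * ∑ ω, μ ω * π.prob ω a * (v a ω - v b ω) +
          δ * (P * (∑ ω, η a ω * v a ω - ∑ ω, η a ω * v b ω)) := by
      rw [← Finset.sum_sub_distrib, Finset.mul_sum, Finset.mul_sum, Finset.mul_sum,
        ← Finset.sum_add_distrib]
      refine Finset.sum_congr rfl fun ω _ => ?_
      rw [hw]
      ring
    have h1 : 0 ≤ (1 - δ) * ∑ ω, μ ω * π.prob ω a * (v a ω - v b ω) :=
      mul_nonneg (by linarith) (hπ a b)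
    have h2 : D ≤ ∑ ω, η a ω * v a ω - ∑ ω, η a ω * v b ω := by linarith [(hη a).2 b hba]
    have h3 := mul_le_mul_of_nonneg_left (mul_le_mul_of_nonneg_left h2 hP0) hδ0.le
    rw [e1, ← hδD]
    linarith
  have hterm : ∀ ω, ν ω * π'.prob ω a * (v a ω - v b ω) =
      (1 - y) * (ν ω / μ ω * w a ω * (v a ω - v b ω)) +
        ν ω / μ ω * ((if a = optAct v ω then y * χ ω else 0) * (v a ω - v b ω)) := fun ω => by
    rw [hπ']
    field_simp
  -- Per unit of mass, the tilt gives the margin `δ D = 2 e / p₀`; replacing `μ` by `ν` costs at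
  -- most half of it.
  have hwν : e / p₀ * P ≤ ∑ ω, ν ω / μ ω * w a ω * (v a ω - v b ω) := by
    have : ∑ ω, (w a ω * (v a ω - v b ω) - e / p₀ * w a ω) ≤
        ∑ ω, ν ω / μ ω * w a ω * (v a ω - v b ω) := by
      refine Finset.sum_le_sum fun ω _ => ?_
      have h1 : |ν ω / μ ω - 1| ≤ e / p₀ := by
        have : ν ω / μ ω - 1 = (ν ω - μ ω) / μ ω := by
          have := (hμ ω).ne'
          field_simp
        rw [this, abs_div, abs_of_pos (hμ ω), div_le_div_iff₀ (hμ ω) hp₀]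
        exact hμν ω
      have h2 : |v a ω - v b ω| ≤ 1 := by
        rw [abs_le]; constructor <;> linarith [(hv a ω).1, (hv a ω).2, (hv b ω).1, (hv b ω).2]
      have h3 : -(e / p₀) ≤ (ν ω / μ ω - 1) * (v a ω - v b ω) := by
        refine (abs_le.1 ?_).1
        rw [abs_mul]
        exact (mul_le_of_le_one_right (abs_nonneg _) h2).trans h1
      nlinarith [mul_le_mul_of_nonneg_left h3 (hw0 ω)]
    rw [Finset.sum_sub_distrib, ← Finset.mul_sum, hwP] at this
    linarith
  have hrev : ∀ ω, 0 ≤ ν ω / μ ω *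
      ((if a = optAct v ω then y * χ ω else 0) * (v a ω - v b ω)) := fun ω => by
    refine mul_nonneg (div_pos (hν ω) (hμ ω)).le ?_
    split_ifs with ha
    · refine mul_nonneg (mul_nonneg hy0 (hχ.1 ω)) ?_
      rw [ha]
      exact sub_nonneg.2 (le_optAct v ω b)
    · simp
  by_cases hz : ∀ ω, π'.prob ω a = 0
  · exact Or.inl hz
  right
  simp only [hterm, Finset.sum_add_distrib, ← Finset.mul_sum]
  -- If `P = 0`, then `a` is sent only when it reveals a state where it is optimal, and strictness
  -- comes from the gap `G` instead of `D`.
  rcases hP0.eq_or_lt with hP0 | hP0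
  · have hwz : ∀ ω, w a ω = 0 := fun ω =>
      (Finset.sum_eq_zero_iff_of_nonneg fun ω _ => hw0 ω).1 (hwP.trans hP0.symm) ω
        (Finset.mem_univ ω)
    simp only [hwz, mul_zero, zero_mul, Finset.sum_const_zero, zero_add]
    push Not at hz
    obtain ⟨ω, hω⟩ := hz
    refine Finset.sum_pos' (fun ω _ => hrev ω) ⟨ω, Finset.mem_univ ω, ?_⟩
    rw [hπ', hwz] at hω
    by_cases ha : a = optAct v ω
    · rw [if_pos ha] at hω ⊢
      have hg := hG.gap (ω := ω) (a := b) (by rwa [← ha])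
      rw [← ha] at hg
      have hyχ : 0 < y * χ ω := lt_of_le_of_ne (mul_nonneg hy0 (hχ.1 ω)) fun h => by
        rw [← h] at hω; simp at hω
      exact mul_pos (div_pos (hν ω) (hμ ω)) (mul_pos hyχ (by linarith [hG.1]))
    · rw [if_neg ha] at hω
      simp at hω
  · have h1 : 0 < e / p₀ * P := mul_pos (div_pos he hp₀) hP0
    exact add_pos_of_pos_of_nonneg (mul_pos (by linarith) (h1.trans_le hwν))
      (Finset.sum_nonneg fun ω _ => hrev ω)

theorem IsRobustification.isPersuasive {v : A → Ω → ℝ} {p₀ D e G : ℝ} (hp₀ : 0 < p₀)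
    (hp₁ : p₀ ≤ 1) (hD : 0 < D) (he : 0 < e) (hδ : 2 * e / (p₀ * D) < p₀)
    (hv : ∀ a ω, v a ω ∈ Set.Icc (0 : ℝ) 1) (hG : HasUniqueOptimalActions v G) {μ ν : Ω → ℝ}
    (hμ : ∀ ω, 0 < μ ω) (hν : ∀ ω, 0 < ν ω) (hμν : ∀ ω, |ν ω - μ ω| * p₀ ≤ e * μ ω)
    {π π' : Scheme Ω A} (hπ : IsPersuasive v μ π) (h : IsRobustification v p₀ D e μ π π') :
    IsPersuasive v ν π' := by
  intro a b
  by_cases hba : b = a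
  · simp [hba]
  rcases h.eq_zero_or_pos hp₀ hp₁ hD he hδ hv hG hμ hν hμν hπ hba with h0 | h0
  · simp [h0]
  · exact h0.le

theorem IsRobustification.utility_le {u v : A → Ω → ℝ} {p₀ D e : ℝ} (hp₀ : 0 < p₀)
    (hp₁ : p₀ ≤ 1) (hD : 0 < D) (he : 0 < e) (hδ : 2 * e / (p₀ * D) ≤ p₀)
    (hu : ∀ a ω, u a ω ∈ Set.Icc (0 : ℝ) 1) {μ : Ω → ℝ} (hμ : ∀ ω, 0 < μ ω)
    (hμ1 : ∑ ω, μ ω = 1) {π π' : Scheme Ω A} (h : IsRobustification v p₀ D e μ π π') :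
    utility u μ π id ≤ utility u μ π' id + 2 * e / (p₀ * D) / p₀ + 2 * e / (p₀ * D) := by
  obtain ⟨δ, y, η, w, χ, hδd, hη, hw, hy0, hy, hχ, -, hπ'⟩ := h
  rw [← hδd] at hδ ⊢
  have hδ0 : 0 < δ := by rw [hδd]; exact div_pos (by linarith) (mul_pos hp₀ hD)
  have hy1 : y ≤ 1 := hy.trans ((div_le_one hp₀).2 hδ)
  have hU0 := utility_nonneg hu (fun ω => (hμ ω).le) π id
  have hU1 := utility_le_one hu ⟨fun ω => (hμ ω).le, hμ1⟩ π id
  -- The fraction `(1 - y)(1 - δ)` of the joint law of states and recommendations survives; the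
  -- added mass has nonnegative utility.
  have key : (1 - y) * (1 - δ) * utility u μ π id ≤ utility u μ π' id := by
    unfold utility
    rw [Finset.mul_sum]
    refine Finset.sum_le_sum fun ω _ => ?_
    rw [mul_left_comm]
    refine mul_le_mul_of_nonneg_left ?_ (hμ ω).le
    rw [Finset.mul_sum]
    refine Finset.sum_le_sum fun a _ => ?_
    rw [← mul_assoc]
    refine mul_le_mul_of_nonneg_right ?_ (hu _ _).1
    rw [hπ', le_div_iff₀ (hμ ω), hw]
    have h1 : 0 ≤ (1 - y) * (δ * ((∑ ω', μ ω' * π.prob ω' a) * η a ω)) :=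
      mul_nonneg (by linarith) (mul_nonneg hδ0.le (mul_nonneg (Finset.sum_nonneg fun ω _ =>
        mul_nonneg (hμ ω).le (π.nonneg ω a)) ((hη a).1.1 ω)))
    have h2 : 0 ≤ if a = optAct v ω then y * χ ω else 0 := by
      split_ifs
      · exact mul_nonneg hy0 (hχ.1 ω)
      · exact le_rfl
    nlinarith
  nlinarith [mul_nonneg hy0 hδ0.le]

/-- A robustified optimal scheme for a prior close to `μ` is nearly optimal for `μ`. -/
theorem optUtility_le_of_isRobustOptimal {u v : A → Ω → ℝ} {p₀ D e G κ : ℝ} (hp₀ : 0 < p₀)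
    (hp₁ : p₀ ≤ 1) (hD : IsDominanceMargin v D) (he : 0 < e) (hδ : 2 * e / (p₀ * D) < p₀)
    (hu : ∀ a ω, u a ω ∈ Set.Icc (0 : ℝ) 1) (hv : ∀ a ω, v a ω ∈ Set.Icc (0 : ℝ) 1)
    (hG : HasUniqueOptimalActions v G) {μ ν : Ω → ℝ} (hμp : ∀ ω, p₀ ≤ μ ω)
    (hμ1 : ∑ ω, μ ω = 1) (hν : ∀ ω, 0 < ν ω) (hν1 : ∑ ω, ν ω = 1)
    (hμν : ∀ ω, |ν ω - μ ω| * p₀ ≤ e * μ ω) (hκ : ∑ ω, |μ ω - ν ω| ≤ κ)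
    {π' : Scheme Ω A} (h : IsRobustOptimal u v p₀ D e ν π') :
    optUtility S u v μ ≤ utility u μ π' id +
      2 * (2 * e / (p₀ * D) / p₀ + 2 * e / (p₀ * D) + κ) := by
  have hμ : ∀ ω, 0 < μ ω := fun ω => hp₀.trans_le (hμp ω)
  have hδ0 : 0 ≤ 2 * e / (p₀ * D) := (div_pos (by linarith) (mul_pos hp₀ hD.1)).le
  have hκ0 : 0 ≤ κ := (Finset.sum_nonneg fun _ _ => abs_nonneg _).trans hκ
  have hκ' : ∑ ω, |ν ω - μ ω| ≤ κ := by simpa only [abs_sub_comm] using hκ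
  obtain ⟨π₁, hopt, hrob⟩ := h
  have hU' : 0 ≤ utility u μ π' id := utility_nonneg hu (fun ω => (hμ ω).le) π' id
  refine Real.sSup_le ?_ (by positivity)
  rintro x ⟨π, α, hα, rfl⟩
  rw [← utility_merge]
  have hper := isPersuasive_merge hα
  -- The competitor is persuasive only for `μ`. Its robustification is also persuasive for `ν`,
  -- where the optimality of `π₁` applies.
  obtain ⟨π₂, h₂⟩ := exists_isRobustification hp₀ hp₁ hD he hδ.le hμ1
    (fun ω => by nlinarith [hμp ω, hμ ω]) (π.merge α)
  have h3 := h₂.utility_le hp₀ hp₁ hD.1 he hδ.le hu hμ hμ1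
  have h4 := utility_le_add_sum_abs hu μ ν π₂ id
  have h5 := hopt.2 π₂ (h₂.isPersuasive hp₀ hp₁ hD.1 he hδ hv hG hμ hν hμν hper)
  have h6 := hrob.utility_le hp₀ hp₁ hD.1 he hδ.le hu hν hν1
  have h7 := utility_le_add_sum_abs hu ν μ π' id
  linarith

/-- Discharges the existence proviso in `Choices.Valid.exploit_spec`. -/
theorem exists_isRobustOptimal (u : A → Ω → ℝ) {v : A → Ω → ℝ} {p₀ D e : ℝ} (hp₀ : 0 < p₀)
    (hp₁ : p₀ ≤ 1) (hD : IsDominanceMargin v D) (he : 0 < e) (hδ : 2 * e / (p₀ * D) ≤ p₀)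
    {μ : Ω → ℝ} (hμ : ∑ ω, μ ω = 1) (hμp : ∀ ω, p₀ ≤ (1 + p₀) * μ ω) :
    ∃ π', IsRobustOptimal u v p₀ D e μ π' := by
  obtain ⟨π, hπ⟩ := exists_isOptimalDirect u v (μ := μ) fun ω =>
    (pos_of_mul_pos_right (hp₀.trans_le (hμp ω)) (by linarith)).le
  obtain ⟨π', h⟩ := exists_isRobustification hp₀ hp₁ hD he hδ hμ hμp π
  exact ⟨π', π, hπ, h⟩

theorem Scheme.embed_apply [DecidableEq S] (ι : A ↪ S) (π : Scheme Ω A) (ω : Ω) (a : A) :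
    (π.embed ι).prob ω (ι a) = π.prob ω a := by
  simp [Scheme.embed]

theorem Scheme.sum_embed_mul [DecidableEq S] (ι : A ↪ S) (π : Scheme Ω A) (ω : Ω) (f : S → ℝ) :
    ∑ s, (π.embed ι).prob ω s * f s = ∑ a, π.prob ω a * f (ι a) := by
  simp only [Scheme.embed, Finset.sum_mul]
  rw [Finset.sum_comm]
  simp [ite_mul]

/-- The recommendations of a robustified scheme are followed under all close priors. -/
theorem IsRobustification.utility_embed [DecidableEq S] (ι : A ↪ S) (u : A → Ω → ℝ)
    {v : A → Ω → ℝ} {p₀ D e G : ℝ} (hp₀ : 0 < p₀)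
    (hp₁ : p₀ ≤ 1) (hD : 0 < D) (he : 0 < e) (hδ : 2 * e / (p₀ * D) < p₀)
    (hv : ∀ a ω, v a ω ∈ Set.Icc (0 : ℝ) 1) (hG : HasUniqueOptimalActions v G) {μ ν : Ω → ℝ}
    (hμ : ∀ ω, 0 < μ ω) (hν : ∀ ω, 0 < ν ω) (hμν : ∀ ω, |ν ω - μ ω| * p₀ ≤ e * μ ω)
    {π π' : Scheme Ω A} (hπ : IsPersuasive v μ π) (h : IsRobustification v p₀ D e μ π π')
    {α : S → A} (hα : ∀ s, IsBestResponse v ν (π'.embed ι) s (α s)) :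
    utility u ν (π'.embed ι) α = utility u ν π' id := by
  unfold utility
  refine Finset.sum_congr rfl fun ω _ => ?_
  rw [π'.sum_embed_mul ι ω fun s => u (α s) ω]
  congr 1
  refine Finset.sum_congr rfl fun a _ => ?_
  by_cases hb : α (ι a) = a
  · rw [hb]; rfl
  -- An answer other than `a` contradicts strict optimality, unless the recommendation has
  -- probability zero and so does not matter.
  · rcases h.eq_zero_or_pos hp₀ hp₁ hD he hδ hv hG hμ hν hμν hπ hb with h0 | h0
    · rw [h0]; simp
    · have := hα (ι a) a
      simp only [Scheme.embed_apply] at this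
      simp only [mul_sub, Finset.sum_sub_distrib] at h0
      linarith

end Static

/-! ### Accuracy of the searches and of the estimated prior. -/

section Estimation

variable {Ω A S : Type*} [Fintype Ω] [Fintype A] [Fintype S] [Nonempty A]

/-- The state `(l, r, b)` of a binary search for `μ ω₁ / μ ω₂`: the action `optAct v ω₁` is optimal
at the signaling ratio `l`, and at the ratio `r` it is no better than `b`. -/
structure SearchInvariant (v : A → Ω → ℝ) (μ : Ω → ℝ) (ω₁ ω₂ : Ω) (l r : ℝ) (b : A) : Prop where
  nonneg : 0 ≤ l
  nonneg_right : 0 ≤ r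
  ne : b ≠ optAct v ω₁
  lower : ∀ a, l * (μ ω₂ * (v a ω₂ - v (optAct v ω₁) ω₂)) ≤
    μ ω₁ * (v (optAct v ω₁) ω₁ - v a ω₁)
  upper : μ ω₁ * (v (optAct v ω₁) ω₁ - v b ω₁) ≤ r * (μ ω₂ * (v b ω₂ - v (optAct v ω₁) ω₂))

theorem SearchInvariant.init {v : A → Ω → ℝ} {G p₀ : ℝ} (hG : HasUniqueOptimalActions v G)
    (hv : ∀ a ω, v a ω ∈ Set.Icc (0 : ℝ) 1) {μ : Ω → ℝ} (hμ : μ ∈ stdSimplex ℝ Ω) (hp₀ : 0 < p₀)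
    (hμp : ∀ ω, p₀ ≤ μ ω) {ω₁ ω₂ : Ω} (h : Distinguishable v ω₁ ω₂) :
    SearchInvariant v μ ω₁ ω₂ 0 (1 / (G * p₀)) (optAct v ω₂) where
  nonneg := le_rfl
  nonneg_right := (one_div_pos.2 (mul_pos hG.1 hp₀)).le
  ne := h.symm
  lower a := by
    rw [zero_mul]
    exact mul_nonneg (hμ.1 _) (sub_nonneg.2 (le_optAct v ω₁ a))
  upper := by
    -- At the ratio `1 / (G p₀)` the gain of `optAct v ω₁` in `ω₁`, weighted at most 1, is offset by
    -- its loss in `ω₂`, weighted at least `G p₀`.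
    have h1 : μ ω₁ * (v (optAct v ω₁) ω₁ - v (optAct v ω₂) ω₁) ≤ 1 := by
      have h2 : μ ω₁ ≤ 1 := by
        rw [← hμ.2]
        exact Finset.single_le_sum (fun ω _ => hμ.1 ω) (Finset.mem_univ ω₁)
      have h3 := le_optAct v ω₁ (optAct v ω₂)
      have h4 := (hv (optAct v ω₁) ω₁).2
      have h5 := (hv (optAct v ω₂) ω₁).1
      exact mul_le_one₀ h2 (by linarith) (by linarith)
    have h2 : G * p₀ ≤ μ ω₂ * (v (optAct v ω₂) ω₂ - v (optAct v ω₁) ω₂) := by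
      rw [mul_comm]
      exact mul_le_mul (hμp ω₂) (hG.gap h).le hG.1.le (hμ.1 ω₂)
    refine h1.trans ?_
    rw [div_mul_eq_mul_div, one_mul, one_le_div (mul_pos hG.1 hp₀)]
    exact h2

/-- The invariant puts the ratio between `l c / p` and `r c / p`, with `c ≤ 1` and `p > G`; hence
the stopping rule `r - l ≤ ε G` yields the error `ε`. -/
theorem SearchInvariant.output {v : A → Ω → ℝ} {G ε : ℝ} (hG : HasUniqueOptimalActions v G)
    {μ : Ω → ℝ} (hμ : ∀ ω, 0 < μ ω) (hv : ∀ a ω, v a ω ∈ Set.Icc (0 : ℝ) 1) {ω₁ ω₂ : Ω}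
    {l r : ℝ} {b : A} (h : SearchInvariant v μ ω₁ ω₂ l r b) (hε : 0 ≤ ε) (hlr : r - l ≤ ε * G) :
    let x := l * ((v b ω₂ - v (optAct v ω₁) ω₂) / (v (optAct v ω₁) ω₁ - v b ω₁))
    0 ≤ x ∧ x ≤ μ ω₁ / μ ω₂ ∧ μ ω₁ / μ ω₂ ≤ x + ε := by
  intro x
  have hg := hG.gap h.ne
  have hG0 := hG.1
  have hlow := h.lower b
  have hup := h.upper
  have hl := h.nonneg
  have h1 : v b ω₂ - v (optAct v ω₁) ω₂ ≤ 1 := by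
    linarith [(hv b ω₂).2, (hv (optAct v ω₁) ω₂).1]
  set p := v (optAct v ω₁) ω₁ - v b ω₁ with hp
  set c := v b ω₂ - v (optAct v ω₁) ω₂ with hc
  have hp0 : 0 < p := hG0.trans hg
  have hm1 := hμ ω₁
  have hm2 := hμ ω₂
  have hm1p := mul_pos hm1 hp0
  have hx : x = l * c / p := by simp only [x]; ring
  have hrc : 0 < r * c := by
    have : 0 < μ ω₂ * (r * c) := by linarith
    exact pos_of_mul_pos_right this hm2.le
  have hc0 : 0 < c := pos_of_mul_pos_right hrc h.nonneg_right
  refine ⟨?_, ?_, ?_⟩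
  · rw [hx]; positivity
  · rw [hx, div_le_div_iff₀ hp0 hm2]
    linarith
  · have h2 : (r - l) * c ≤ ε * p := by
      have h3 : (r - l) * c ≤ ε * G * c := mul_le_mul_of_nonneg_right hlr hc0.le
      have h4 : ε * G * c ≤ ε * G * 1 := mul_le_mul_of_nonneg_left h1 (by positivity)
      have h5 : ε * G ≤ ε * p := mul_le_mul_of_nonneg_left hg.le hε
      linarith
    have h6 : x + ε = (l * c + ε * p) / p := by rw [hx]; field_simp
    rw [h6, div_le_div_iff₀ hm2 hp0]
    nlinarith [mul_le_mul_of_nonneg_right h2 hm2.le]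

/-- The receiver's answer to the test signal halves the search interval. -/
theorem best_response_test {v : A → Ω → ℝ} {μ : Ω → ℝ} {π : Scheme Ω S} {s : S} {ω₁ ω₂ : Ω}
    {q : ℝ} (hne : ω₁ ≠ ω₂) (hq : 0 < q) (h₁ : π.prob ω₁ s = min 1 (1 / q))
    (h₂ : π.prob ω₂ s = min q 1) (h₀ : ∀ ω, ω ≠ ω₁ → ω ≠ ω₂ → π.prob ω s = 0) {a : A}
    (h : IsBestResponse v μ π s a) (b : A) :
    μ ω₁ * v b ω₁ + q * (μ ω₂ * v b ω₂) ≤ μ ω₁ * v a ω₁ + q * (μ ω₂ * v a ω₂) := by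
  have hsum : ∀ c : A, ∑ ω, μ ω * π.prob ω s * v c ω =
      min 1 (1 / q) * (μ ω₁ * v c ω₁ + q * (μ ω₂ * v c ω₂)) := by
    intro c
    rw [Fintype.sum_eq_add ω₁ ω₂ hne (fun ω hω => by rw [h₀ ω hω.1 hω.2]; ring), h₁, h₂]
    -- The factor `min 1 (1 / q)` is common to both states and cancels, so only `q` affects the
    -- answer.
    have : min q 1 = min 1 (1 / q) * q := by
      rw [min_mul_of_nonneg _ _ hq.le, one_mul, one_div, inv_mul_cancel₀ hq.ne']
    rw [this]
    ring
  have := h b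
  rw [hsum, hsum] at this
  exact le_of_mul_le_mul_left this (lt_min one_pos (one_div_pos.2 hq))

/-- According to the side of 1 on which `q` lies, the signal is certain in `ω₁` or in `ω₂`, a state
of mass at least `p₀`. -/
theorem le_prob_test_signal {μ : Ω → ℝ} {p₀ : ℝ} (hμ : ∀ ω, 0 ≤ μ ω) (hμp : ∀ ω, p₀ ≤ μ ω)
    {π : Scheme Ω S} {s : S} {ω₁ ω₂ : Ω} {q : ℝ} (hq : 0 < q)
    (h₁ : π.prob ω₁ s = min 1 (1 / q)) (h₂ : π.prob ω₂ s = min q 1) :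
    p₀ ≤ ∑ ω, μ ω * π.prob ω s := by
  have key : ∀ ω, π.prob ω s = 1 → p₀ ≤ ∑ ω, μ ω * π.prob ω s := fun ω h => by
    refine (hμp ω).trans ?_
    have := Finset.single_le_sum (f := fun ω => μ ω * π.prob ω s)
      (fun ω _ => mul_nonneg (hμ ω) (π.nonneg ω s)) (Finset.mem_univ ω)
    simpa [h] using this
  rcases le_total q 1 with h | h
  · exact key ω₁ (by rw [h₁, min_eq_left ((one_le_div hq).2 h)])
  · exact key ω₂ (by rw [h₂, min_eq_right h])

/-- Error of a quotient of two search outputs. From `p ≤ s` and `2 * ε ≤ p` the denominator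
satisfies `y ≥ p / 2`; its relative error, at most `2 ε / p`, is multiplied by `r / s ≤ 1 / p`. -/
theorem abs_div_sub_div_le {x y r s ε p : ℝ} (hp : 0 < p) (hp1 : p ≤ 1) (hε : 0 ≤ ε)
    (hεp : 2 * ε ≤ p) (hx0 : 0 ≤ x) (hx : x ≤ r) (hx' : r ≤ x + ε) (hy : y ≤ s)
    (hy' : s ≤ y + ε) (hs : p ≤ s) (hrs : r / s ≤ 1 / p) :
    0 ≤ x / y ∧ |x / y - r / s| ≤ 2 * ε / p ^ 2 := by
  have hy2 : p / 2 ≤ y := by linarith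
  have hy0 : 0 < y := by linarith
  have hs0 : 0 < s := by linarith
  refine ⟨by positivity, abs_le.2 ⟨?_, ?_⟩⟩
  · have h1 : x / s ≤ x / y := div_le_div_of_nonneg_left hx0 hy0 hy
    have h2 : r / s ≤ x / s + ε / s := by rw [← add_div]; gcongr
    have h3 : ε / s ≤ 2 * ε / p ^ 2 := by
      apply div_le_div₀ <;> nlinarith
    linarith
  · have h1 : x / y ≤ r / y := by gcongr
    have h2 : r / y - r / s = r / s * ((s - y) / y) := by field_simp
    have h3 : (s - y) / y ≤ ε / (p / 2) := div_le_div₀ hε (by linarith) (by linarith) hy2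
    have h4 : r / s * ((s - y) / y) ≤ 1 / p * (ε / (p / 2)) :=
      mul_le_mul hrs h3 (div_nonneg (by linarith) hy0.le) (by positivity)
    have h5 : 1 / p * (ε / (p / 2)) = 2 * ε / p ^ 2 := by field_simp
    linarith

/-- The estimate is `τ`, the ratios with the entry 1 at `ref`, divided by a total that is at least
1. The errors of the entries and of the total each contribute at most `|Ω| e`. -/
theorem priorEstimate_sum_and_error [DecidableEq Ω] {μ : Ω → ℝ} (hμ : ∀ ω, 0 < μ ω)
    (hμ1 : ∑ ω, μ ω = 1) {ref : Ω} {ρ : Ω → ℝ} {e : ℝ} (he : 0 ≤ e) (hρ : ∀ i, i ≠ ref → 0 ≤ ρ i)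
    (hρe : ∀ i, i ≠ ref → |ρ i - μ i / μ ref| ≤ e) :
    ∑ ω, priorEstimate ref ρ ω = 1 ∧
      ∑ ω, |priorEstimate ref ρ ω - μ ω| ≤ 2 * (Fintype.card Ω * e) := by
  set τ : Ω → ℝ := Function.update ρ ref 1 with hτ
  have hτ0 : ∀ i, 0 ≤ τ i := fun i => by
    by_cases h : i = ref
    · subst h; simp [hτ]
    · simpa [hτ, h] using hρ i h
  have hτe : ∀ i, |τ i - μ i / μ ref| ≤ e := fun i => by
    by_cases h : i = ref
    · subst h; simpa [hτ, div_self (hμ i).ne'] using he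
    · simpa [hτ, h] using hρe i h
  have hZ : ∑ i, τ i = 1 + ∑ i ∈ Finset.univ.erase ref, ρ i := by
    rw [← Finset.add_sum_erase _ _ (Finset.mem_univ ref)]
    congr 1
    · simp [hτ]
    · exact Finset.sum_congr rfl fun i hi => by simp [hτ, Finset.ne_of_mem_erase hi]
  have hZ1 : 1 ≤ ∑ i, τ i := by
    rw [hZ]
    have := Finset.sum_nonneg (s := Finset.univ.erase ref)
      fun i hi => hρ i (Finset.ne_of_mem_erase hi)
    linarith
  have hest : ∀ i, priorEstimate ref ρ i = τ i / ∑ i, τ i := fun i => by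
    unfold priorEstimate
    rw [← hZ]
    split_ifs with h
    · subst h; simp [hτ]
    · simp [hτ, h, div_eq_mul_inv]
  have hZ0 : 0 < ∑ i, τ i := by linarith
  have hsum : ∑ i, μ i / μ ref = 1 / μ ref := by rw [← Finset.sum_div, hμ1]
  set E := ∑ i, |τ i - μ i / μ ref| with hE
  have hEe : E ≤ Fintype.card Ω * e := by
    have := Finset.sum_le_sum (s := Finset.univ) fun i _ => hτe i
    simpa using this
  have hdiff : |1 / μ ref - ∑ i, τ i| ≤ E := by
    rw [← hsum, ← Finset.sum_sub_distrib, hE]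
    refine (Finset.abs_sum_le_sum_abs _ _).trans (le_of_eq ?_)
    exact Finset.sum_congr rfl fun i _ => abs_sub_comm _ _
  refine ⟨by simp only [hest]; rw [← Finset.sum_div, div_self hZ0.ne'], ?_⟩
  have hterm : ∀ i, |priorEstimate ref ρ i - μ i| ≤ |τ i - μ i / μ ref| + μ i * E := fun i => by
    have e1 : (priorEstimate ref ρ i - μ i) * ∑ i, τ i =
        (τ i - μ i / μ ref) + μ i * (1 / μ ref - ∑ i, τ i) := by
      rw [hest]; field_simp; ring
    calc |priorEstimate ref ρ i - μ i| ≤ |priorEstimate ref ρ i - μ i| * ∑ i, τ i :=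
          le_mul_of_one_le_right (abs_nonneg _) hZ1
      _ = |(τ i - μ i / μ ref) + μ i * (1 / μ ref - ∑ i, τ i)| := by
          rw [← e1, abs_mul, abs_of_pos hZ0]
      _ ≤ |τ i - μ i / μ ref| + |μ i * (1 / μ ref - ∑ i, τ i)| := abs_add_le _ _
      _ ≤ _ := by
          rw [abs_mul, abs_of_pos (hμ i)]
          gcongr
          exact (hμ i).le
  calc ∑ i, |priorEstimate ref ρ i - μ i| ≤ ∑ i, (|τ i - μ i / μ ref| + μ i * E) :=
        Finset.sum_le_sum fun i _ => hterm i
    _ = 2 * E := by rw [Finset.sum_add_distrib, ← Finset.sum_mul, hμ1, ← hE]; ring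
    _ ≤ _ := by linarith

end Estimation

/-! ### Expected loss of the learning phase. -/

section Dynamic

variable {Ω A S : Type*} [Fintype Ω] [Fintype A] [Fintype S]

/-- Over at most `T` periods, the strategy `σ` loses at most `B` against the benchmark of `U` per
period. -/
def LossBounded (u v : A → Ω → ℝ) (μ : Ω → ℝ) (U : ℝ) (T : ℕ) (B : ℝ) (σ : Strategy Ω A S) :
    Prop :=
  ∀ n ≤ T, ∀ R : Behavior Ω A S, IsOptimalBehavior v μ R → n * U - expectedTotal u μ n σ R ≤ B

theorem IsOptimalBehavior.tail {v : A → Ω → ℝ} {μ : Ω → ℝ} {R : Behavior Ω A S}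
    (hR : IsOptimalBehavior v μ R) (x : S × A) :
    IsOptimalBehavior v μ fun h => R (x :: h) := fun h => hR (x :: h)

/-- The dynamic programming step. States are drawn independently, so the continuation depends on the
first period only through its signal, which determines the action. -/
theorem loss_succ_le {u : A → Ω → ℝ} {μ : Ω → ℝ} (hμ : μ ∈ stdSimplex ℝ Ω) {U : ℝ} {n : ℕ}
    {σ : Strategy Ω A S} {R : Behavior Ω A S} {C : S → ℝ}
    (h : ∀ s, n * U - expectedTotal u μ n (fun h => σ ((s, R [] (σ []) s) :: h))
      (fun h => R ((s, R [] (σ []) s) :: h)) ≤ C s) :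
    (n + 1 : ℕ) * U - expectedTotal u μ (n + 1) σ R ≤
      U - utility u μ (σ []) (R [] (σ [])) + ∑ s, (∑ ω, μ ω * (σ []).prob ω s) * C s := by
  have hone : ∑ ω, μ ω * ∑ s, (σ []).prob ω s * (n * U) = n * U := by
    simp only [← Finset.sum_mul, (σ []).sum_one, one_mul, hμ.2]
  have e1 : ∑ s, (∑ ω, μ ω * (σ []).prob ω s) * C s =
      ∑ ω, μ ω * ∑ s, (σ []).prob ω s * C s := by
    simp only [Finset.sum_mul, Finset.mul_sum]
    rw [Finset.sum_comm]
    simp only [mul_assoc]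
  have e2 : ∑ ω, μ ω * ∑ s, (σ []).prob ω s * (n * U) -
      ∑ ω, μ ω * ∑ s, (σ []).prob ω s * expectedTotal u μ n
        (fun h => σ ((s, R [] (σ []) s) :: h)) (fun h => R ((s, R [] (σ []) s) :: h)) ≤
      ∑ ω, μ ω * ∑ s, (σ []).prob ω s * C s := by
    rw [← Finset.sum_sub_distrib]
    refine Finset.sum_le_sum fun ω _ => ?_
    rw [← mul_sub, ← Finset.sum_sub_distrib]
    refine mul_le_mul_of_nonneg_left (Finset.sum_le_sum fun s _ => ?_) (hμ.1 ω)
    rw [← mul_sub]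
    exact mul_le_mul_of_nonneg_left (h s) ((σ []).nonneg ω s)
  have e3 : expectedTotal u μ (n + 1) σ R = utility u μ (σ []) (R [] (σ [])) +
      ∑ ω, μ ω * ∑ s, (σ []).prob ω s * expectedTotal u μ n
        (fun h => σ ((s, R [] (σ []) s) :: h)) (fun h => R ((s, R [] (σ []) s) :: h)) := by
    rw [expectedTotal]
    simp only [utility, mul_add, Finset.sum_add_distrib]
  rw [e1, e3]
  push_cast
  linarith

theorem lossBounded_const {u v : A → Ω → ℝ} {μ : Ω → ℝ} (hμ : μ ∈ stdSimplex ℝ Ω) {U κ B : ℝ}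
    {T : ℕ} (hκ : 0 ≤ κ) (hB : T * κ ≤ B) {π : Scheme Ω S}
    (h : ∀ α : S → A, (∀ s, IsBestResponse v μ π s (α s)) → U - utility u μ π α ≤ κ) :
    LossBounded u v μ U T B (fun _ => π) := by
  have key : ∀ (n : ℕ) (R : Behavior Ω A S), IsOptimalBehavior v μ R →
      n * U - expectedTotal u μ n (fun _ => π) R ≤ n * κ := by
    intro n
    induction n with
    | zero => intro R _; simp [expectedTotal]
    | succ n ih =>
      intro R hR
      refine (loss_succ_le hμ (C := fun _ => n * κ) fun s => ih _ (hR.tail _)).trans ?_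
      have e1 : ∑ s, (∑ ω, μ ω * π.prob ω s) * (n * κ) = n * κ := by
        rw [← Finset.sum_mul, Finset.sum_comm]
        simp only [← Finset.mul_sum, π.sum_one, mul_one, hμ.2, one_mul]
      have := h (R [] π) (hR [] π)
      push_cast
      linarith
  intro n hn R hR
  refine (key n R hR).trans (le_trans ?_ hB)
  gcongr

variable [Nonempty A] [DecidableEq A] [DecidableEq S]

theorem searchFrom_of_le {v : A → Ω → ℝ} {G ε : ℝ} {c : Choices Ω A S} {ω₁ ω₂ : Ω}
    {k : ℝ → Strategy Ω A S} {l r : ℝ} {b : A} (h : r - l ≤ ε * G) :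
    searchFrom v G ε c ω₁ ω₂ k l r b =
      k (l * ((v b ω₂ - v (optAct v ω₁) ω₂) / (v (optAct v ω₁) ω₁ - v b ω₁))) := by
  funext x
  rw [searchFrom.eq_def, if_pos h]

theorem searchFrom_nil {v : A → Ω → ℝ} {G ε : ℝ} {c : Choices Ω A S} {ω₁ ω₂ : Ω}
    {k : ℝ → Strategy Ω A S} {l r : ℝ} {b : A} (h : ¬ r - l ≤ ε * G) :
    searchFrom v G ε c ω₁ ω₂ k l r b [] = c.probe ω₁ ω₂ ((l + r) / 2) := by
  rw [searchFrom.eq_def, if_neg h]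

/-- After one period the strategy is again a search, with an updated interval, so induction on the
horizon applies. -/
theorem searchFrom_cons {v : A → Ω → ℝ} {G ε : ℝ} {c : Choices Ω A S} {ω₁ ω₂ : Ω}
    {k : ℝ → Strategy Ω A S} {l r : ℝ} {b : A} (h : ¬ r - l ≤ ε * G) (s : S) (a : A) :
    (fun x => searchFrom v G ε c ω₁ ω₂ k l r b ((s, a) :: x)) =
      if s = c.sig ω₁ ω₂ ((l + r) / 2) then
        if a = optAct v ω₁ then searchFrom v G ε c ω₁ ω₂ k ((l + r) / 2) r b
        else searchFrom v G ε c ω₁ ω₂ k l ((l + r) / 2) a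
      else searchFrom v G ε c ω₁ ω₂ k l r b := by
  funext x
  conv_lhs => rw [searchFrom.eq_def, if_neg h]
  simp only
  split_ifs <;> rfl

/-- A search that needs at most `j` more halvings takes at most `j / p₀` periods in expectation. -/
theorem loss_searchFrom_le {u v : A → Ω → ℝ} (hu : ∀ a ω, u a ω ∈ Set.Icc (0 : ℝ) 1)
    (hv : ∀ a ω, v a ω ∈ Set.Icc (0 : ℝ) 1) {μ : Ω → ℝ} (hμ : μ ∈ stdSimplex ℝ Ω) {p₀ : ℝ}
    (hp₀ : 0 < p₀) (hμp : ∀ ω, p₀ ≤ μ ω) {G : ℝ} (hG : HasUniqueOptimalActions v G)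
    {D ε ε' : ℝ} (hε : 0 < ε) {c : Choices Ω A S} (hc : c.Valid u v p₀ D ε') {U : ℝ} (hU : U ≤ 1)
    {T : ℕ} {B : ℝ} (hB : 0 ≤ B) {ω₁ ω₂ : Ω} (hne : ω₁ ≠ ω₂) {k : ℝ → Strategy Ω A S}
    (hk : ∀ x, 0 ≤ x → x ≤ μ ω₁ / μ ω₂ → μ ω₁ / μ ω₂ ≤ x + ε → LossBounded u v μ U T B (k x))
    {n : ℕ} (hn : n ≤ T) {j : ℕ} {l r : ℝ} {b : A} (hinv : SearchInvariant v μ ω₁ ω₂ l r b)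
    (hj : r - l ≤ ε * G * 2 ^ j) {R : Behavior Ω A S} (hR : IsOptimalBehavior v μ R) :
    n * U - expectedTotal u μ n (searchFrom v G ε c ω₁ ω₂ k l r b) R ≤ B + j / p₀ := by
  have hG0 := hG.1
  induction n generalizing j l r b R with
  | zero =>
    simp only [expectedTotal, Nat.cast_zero, zero_mul, sub_zero]
    positivity
  | succ n ih =>
    by_cases hlr : r - l ≤ ε * G
    · obtain ⟨h0, h1, h2⟩ := hinv.output hG (fun ω => hp₀.trans_le (hμp ω)) hv hε.le hlr
      rw [searchFrom_of_le hlr]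
      refine (hk _ h0 h1 h2 _ hn R hR).trans ?_
      have : 0 ≤ (j : ℝ) / p₀ := by positivity
      linarith
    -- An interval that is still too long requires at least one more halving.
    · obtain ⟨j, rfl⟩ : ∃ j', j = j' + 1 := Nat.exists_eq_succ_of_ne_zero fun h => by
        subst h; rw [pow_zero, mul_one] at hj; exact hlr hj
      have hn' : n ≤ T := by omega
      set q := (l + r) / 2 with hq
      have hq0 : 0 < q := by
        have := mul_pos hε hG0
        have := hinv.nonneg
        push Not at hlr
        linarith
      rw [pow_succ] at hj
      obtain ⟨s1, s2, s3⟩ := hc.probe_spec ω₁ ω₂ q hne hq0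
      set s₀ := c.sig ω₁ ω₂ q with hs₀
      -- The potential drops by `1 / p₀` if the test signal is sent and stays put otherwise. The
      -- expected drop is at least 1, which pays for the period.
      refine (loss_succ_le hμ
        (C := fun s => B + (j + 1 : ℕ) / p₀ - if s = s₀ then 1 / p₀ else 0) fun s => ?_).trans ?_
      · rw [searchFrom_nil hlr, searchFrom_cons hlr, ← hq, ← hs₀]
        have hbr := hR [] (c.probe ω₁ ω₂ q) s
        split_ifs with hs ha
        · have e1 : B + (j + 1 : ℕ) / p₀ - 1 / p₀ = B + j / p₀ := by push_cast; ring
          rw [e1]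
          refine ih hn' ⟨hq0.le, hinv.nonneg_right, hinv.ne, fun b' => ?_, hinv.upper⟩ ?_ (hR.tail _)
          · rw [hs] at hbr ha
            have := best_response_test hne hq0 s1 s2 s3 hbr b'
            rw [ha] at this
            linarith
          · rw [hq]; linarith
        · have e1 : B + (j + 1 : ℕ) / p₀ - 1 / p₀ = B + j / p₀ := by push_cast; ring
          rw [e1]
          -- The alternative action changes here; the lower bound survives because it holds against
          -- every action, not only `b`.
          refine ih hn' ⟨hinv.nonneg, hq0.le, ha, hinv.lower, ?_⟩ ?_ (hR.tail _)
          · subst hs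
            have := best_response_test hne hq0 s1 s2 s3 hbr (optAct v ω₁)
            linarith
          · rw [hq]; linarith
        · rw [sub_zero]
          exact ih hn' hinv (by rw [pow_succ]; exact hj) (hR.tail _)
      · rw [searchFrom_nil hlr, ← hq]
        have hutil := utility_nonneg hu hμ.1 (c.probe ω₁ ω₂ q) (R [] (c.probe ω₁ ω₂ q))
        have hp := le_prob_test_signal hμ.1 hμp hq0 s1 s2
        have htot : ∑ s, ∑ ω, μ ω * (c.probe ω₁ ω₂ q).prob ω s = 1 := by
          rw [Finset.sum_comm]
          simp only [← Finset.mul_sum, (c.probe ω₁ ω₂ q).sum_one, mul_one, hμ.2]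
        have h1 : 1 ≤ (∑ ω, μ ω * (c.probe ω₁ ω₂ q).prob ω s₀) * (1 / p₀) := by
          rw [mul_one_div, one_le_div hp₀]; exact hp
        simp only [mul_sub, Finset.sum_sub_distrib, ← Finset.sum_mul, htot, one_mul, mul_ite,
          mul_zero, Finset.sum_ite_eq', Finset.mem_univ, if_true]
        linarith

theorem lossBounded_search {u v : A → Ω → ℝ} (hu : ∀ a ω, u a ω ∈ Set.Icc (0 : ℝ) 1)
    (hv : ∀ a ω, v a ω ∈ Set.Icc (0 : ℝ) 1) {μ : Ω → ℝ} (hμ : μ ∈ stdSimplex ℝ Ω) {p₀ : ℝ}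
    (hp₀ : 0 < p₀) (hμp : ∀ ω, p₀ ≤ μ ω) {G : ℝ} (hG : HasUniqueOptimalActions v G)
    {D ε ε' : ℝ} (hε : 0 < ε) {c : Choices Ω A S} (hc : c.Valid u v p₀ D ε') {U : ℝ} (hU : U ≤ 1)
    {T : ℕ} {B : ℝ} (hB : 0 ≤ B) {ω₁ ω₂ : Ω} (hd : Distinguishable v ω₁ ω₂) {N : ℕ}
    (hN : 1 / (G * p₀) ≤ ε * G * 2 ^ N) {k : ℝ → Strategy Ω A S}
    (hk : ∀ x, 0 ≤ x → x ≤ μ ω₁ / μ ω₂ → μ ω₁ / μ ω₂ ≤ x + ε → LossBounded u v μ U T B (k x)) :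
    LossBounded u v μ U T (B + N / p₀) (search v p₀ G ε c ω₁ ω₂ k) := fun _ hn _ hR =>
  loss_searchFrom_le hu hv hμ hp₀ hμp hG hε hc hU hB (fun h => hd (by rw [h])) hk hn
    (.init hG hv hμ hp₀ hμp hd) (by rwa [sub_zero]) hR

open Classical in
/-- The number of binary searches that the comparison of two states takes. -/
def numSearches (v : A → Ω → ℝ) (i j : Ω) : ℕ := if Distinguishable v i j then 1 else 2

/-- A search is bounded in terms of its continuation, so for nested searches the costs `N / p₀` add
up. -/
theorem lossBounded_pairEstimate {u v : A → Ω → ℝ} (hu : ∀ a ω, u a ω ∈ Set.Icc (0 : ℝ) 1)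
    (hv : ∀ a ω, v a ω ∈ Set.Icc (0 : ℝ) 1) {μ : Ω → ℝ} (hμ : μ ∈ stdSimplex ℝ Ω) {p₀ : ℝ}
    (hp₀ : 0 < p₀) (hμp : ∀ ω, p₀ ≤ μ ω) {G : ℝ} (hG : HasUniqueOptimalActions v G)
    {D ε ε' : ℝ} (hε : 0 < ε) (hεp : 2 * ε ≤ p₀) {c : Choices Ω A S} (hc : c.Valid u v p₀ D ε')
    {U : ℝ} (hU : U ≤ 1) {T : ℕ} {B : ℝ} (hB : 0 ≤ B) {i j : Ω} {N : ℕ}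
    (hN : 1 / (G * p₀) ≤ ε * G * 2 ^ N) {k : ℝ → Strategy Ω A S}
    (hk : ∀ x, 0 ≤ x → |x - μ i / μ j| ≤ 2 * ε / p₀ ^ 2 → LossBounded u v μ U T B (k x)) :
    LossBounded u v μ U T (B + numSearches v i j * (N / p₀)) (pairEstimate v p₀ G ε c i j k) := by
  classical
  have hpos : ∀ ω, 0 < μ ω := fun ω => hp₀.trans_le (hμp ω)
  have hle : ∀ ω, μ ω ≤ 1 := fun ω => by
    rw [← hμ.2]
    exact Finset.single_le_sum (fun ω _ => hμ.1 ω) (Finset.mem_univ ω)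
  have hp1 : p₀ ≤ 1 := (hμp i).trans (hle i)
  by_cases hd : Distinguishable v i j
  · simp only [pairEstimate, numSearches, if_pos hd, Nat.cast_one, one_mul]
    refine lossBounded_search hu hv hμ hp₀ hμp hG hε hc hU hB hd hN fun x h0 h1 h2 => hk x h0 ?_
    have : ε ≤ 2 * ε / p₀ ^ 2 := by
      rw [le_div_iff₀ (by positivity)]
      nlinarith [pow_le_one₀ hp₀.le hp1 (n := 2)]
    rw [abs_le]
    constructor <;> linarith
  · simp only [pairEstimate, numSearches, if_neg hd, Nat.cast_ofNat]
    set m := if Distinguishable v c.d₁ i then c.d₁ else c.d₂ with hm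
    have hij : optAct v i = optAct v j := not_not.1 hd
    -- `c.d₁` and `c.d₂` have different optimal actions, so they cannot both agree with `i`.
    have him : Distinguishable v i m := by
      rw [hm]
      split_ifs with h
      · exact h.symm
      · intro h2
        exact hc.dist ((not_not.1 h).trans h2)
    have hjm : Distinguishable v j m := fun h => him (hij.trans h)
    have hN0 : 0 ≤ (N : ℝ) / p₀ := by positivity
    rw [two_mul, ← add_assoc]
    refine lossBounded_search hu hv hμ hp₀ hμp hG hε hc hU (by positivity) him hN
      fun x hx0 hx1 hx2 => ?_
    refine lossBounded_search hu hv hμ hp₀ hμp hG hε hc hU hB hjm hN fun y hy0 hy1 hy2 => ?_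
    have hm0 := (hpos m).ne'
    have hdiv : μ i / μ m / (μ j / μ m) = μ i / μ j := div_div_div_cancel_right₀ hm0 _ _
    obtain ⟨h1, h2⟩ := abs_div_sub_div_le hp₀ hp1 hε.le hεp hx0 hx1 hx2 hy1 hy2
      (by rw [le_div_iff₀ (hpos m)]; nlinarith [hμp j, hle m])
      (by rw [hdiv]; exact div_le_div₀ zero_le_one (hle i) hp₀ (hμp j))
    rw [hdiv] at h2
    exact hk _ h1 h2

theorem lossBounded_estimateAll [DecidableEq Ω] {u v : A → Ω → ℝ}
    (hu : ∀ a ω, u a ω ∈ Set.Icc (0 : ℝ) 1)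
    (hv : ∀ a ω, v a ω ∈ Set.Icc (0 : ℝ) 1) {μ : Ω → ℝ} (hμ : μ ∈ stdSimplex ℝ Ω) {p₀ : ℝ}
    (hp₀ : 0 < p₀) (hμp : ∀ ω, p₀ ≤ μ ω) {G : ℝ} (hG : HasUniqueOptimalActions v G)
    {D ε ε' : ℝ} (hε : 0 < ε) (hεp : 2 * ε ≤ p₀) {c : Choices Ω A S} (hc : c.Valid u v p₀ D ε')
    {U : ℝ} (hU : U ≤ 1) {T : ℕ} {B : ℝ} (hB : 0 ≤ B) {N : ℕ}
    (hN : 1 / (G * p₀) ≤ ε * G * 2 ^ N) {k : (Ω → ℝ) → Strategy Ω A S}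
    (hk : ∀ ρ : Ω → ℝ, (∀ i, i ≠ c.ref → 0 ≤ ρ i ∧ |ρ i - μ i / μ c.ref| ≤ 2 * ε / p₀ ^ 2) →
      LossBounded u v μ U T B (k ρ)) (is : List Ω) (ρ : Ω → ℝ)
    (hρ : ∀ i, i ≠ c.ref → i ∉ is → 0 ≤ ρ i ∧ |ρ i - μ i / μ c.ref| ≤ 2 * ε / p₀ ^ 2) :
    LossBounded u v μ U T (B + (is.map fun i => numSearches v i c.ref).sum * (N / p₀))
      (estimateAll v p₀ G ε c k is ρ) := by
  induction is generalizing ρ with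
  | nil =>
    simp only [estimateAll, List.map_nil, List.sum_nil, Nat.cast_zero, zero_mul, add_zero]
    exact hk ρ fun i hi => hρ i hi (by simp)
  | cons i is ih =>
    have hN0 : 0 ≤ (N : ℝ) / p₀ := by positivity
    rw [estimateAll, List.map_cons, List.sum_cons, Nat.cast_add, add_mul,
      add_comm (_ * _), ← add_assoc]
    refine lossBounded_pairEstimate hu hv hμ hp₀ hμp hG hε hεp hc hU (by positivity) hN
      fun x hx0 hx => ih _ fun j hj hjs => ?_
    by_cases hji : j = i
    · subst hji
      simpa using ⟨hx0, hx⟩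
    · rw [Function.update_of_ne hji]
      exact hρ j hj (by simp [hji, hjs])

/-- There are `|Ω| - 1` comparisons of at most two searches each. As `c.d₁` and `c.d₂` cannot both
share the optimal action of `c.ref`, at least one comparison needs a single search. -/
theorem sum_numSearches_add_three_le {u v : A → Ω → ℝ} {p₀ D ε : ℝ} {c : Choices Ω A S}
    (hc : c.Valid u v p₀ D ε) :
    (c.others.map fun i => numSearches v i c.ref).sum + 3 ≤ 2 * Fintype.card Ω := by
  classical
  have hlen : c.others.length + 1 = Fintype.card Ω := by
    rw [← List.length_cons (a := c.ref), ← List.toFinset_card_of_nodup hc.nodup, ← Finset.card_univ]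
    congr 1
    ext ω
    simpa using hc.complete ω
  obtain ⟨i, hi⟩ : ∃ i, Distinguishable v i c.ref := by
    by_cases h : Distinguishable v c.d₁ c.ref
    · exact ⟨_, h⟩
    · exact ⟨c.d₂, fun h2 => hc.dist ((not_not.1 h).trans h2.symm)⟩
  have hmem : i ∈ c.others := by
    rcases List.mem_cons.1 (hc.complete i) with h | h
    · exact absurd (by rw [h]) hi
    · exact h
  have hle : ∀ is : List Ω, (is.map fun i => numSearches v i c.ref).sum ≤ 2 * is.length := by
    intro is
    induction is with
    | nil => simp
    | cons j is ih =>
      have : numSearches v j c.ref ≤ 2 := by unfold numSearches; split_ifs <;> norm_num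
      simp only [List.map_cons, List.sum_cons, List.length_cons]
      omega
  obtain ⟨l₁, l₂, hl⟩ := List.append_of_mem hmem
  have h1 := hle l₁
  have h2 := hle l₂
  have h3 : numSearches v i c.ref = 1 := if_pos hi
  rw [hl] at hlen ⊢
  simp only [List.map_append, List.map_cons, List.sum_append, List.sum_cons, h3,
    List.length_append, List.length_cons] at hlen ⊢
  omega

end Dynamic

/-! ### Choice of the constants and the regret bound. -/

section Regret

variable {Ω A S : Type*} [Fintype Ω] [Fintype A] [Fintype S] [Nonempty A]

theorem Distinguishable.nontrivial {v : A → Ω → ℝ} {ω ω' : Ω} (h : Distinguishable v ω ω') :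
    Nontrivial A := ⟨⟨_, _, h⟩⟩

theorem Distinguishable.two_le_card {v : A → Ω → ℝ} {ω ω' : Ω} (h : Distinguishable v ω ω') :
    2 ≤ Fintype.card Ω :=
  Fintype.one_lt_card_iff.2 ⟨ω, ω', fun e => h (by rw [e])⟩

theorem Distinguishable.two_mul_le_one {v : A → Ω → ℝ} {ω ω' : Ω} (h : Distinguishable v ω ω')
    {μ : Ω → ℝ} (hμ : μ ∈ stdSimplex ℝ Ω) {p₀ : ℝ} (hμp : ∀ ω, p₀ ≤ μ ω) : 2 * p₀ ≤ 1 := by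
  classical
  have hne : ω ≠ ω' := fun e => h (by rw [e])
  have h1 := Finset.sum_le_sum_of_subset_of_nonneg (Finset.subset_univ ({ω, ω'} : Finset Ω))
    fun i _ _ => hμ.1 i
  rw [Finset.sum_pair hne, hμ.2] at h1
  linarith [hμp ω, hμp ω']

theorem HasUniqueOptimalActions.lt_one {v : A → Ω → ℝ} {G : ℝ} (hG : HasUniqueOptimalActions v G)
    (hv : ∀ a ω, v a ω ∈ Set.Icc (0 : ℝ) 1) {ω ω' : Ω} (h : Distinguishable v ω ω') : G < 1 := by
  have := hG.gap h
  linarith [(hv (optAct v ω') ω').2, (hv (optAct v ω) ω').1]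

variable [DecidableEq Ω] [DecidableEq A] [DecidableEq S]

/-- Once all ratios are estimated with the accuracy of the binary searches, the total loss of the
remaining periods is at most `2`. -/
theorem lossBounded_exploit (ι : A ↪ S) {u v : A → Ω → ℝ}
    (hu : ∀ a ω, u a ω ∈ Set.Icc (0 : ℝ) 1) (hv : ∀ a ω, v a ω ∈ Set.Icc (0 : ℝ) 1)
    {μ : Ω → ℝ} (hμ : μ ∈ stdSimplex ℝ Ω) {p₀ : ℝ} (hp₀ : 0 < p₀) (hp2 : 2 * p₀ ≤ 1)
    (hμp : ∀ ω, p₀ ≤ μ ω) {G : ℝ} (hG : HasUniqueOptimalActions v G) {D : ℝ}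
    (hD : IsDominanceMargin v D) (hD1 : D ≤ 1) {T : ℕ} (hT : 1 ≤ T) (hn : 0 < Fintype.card Ω)
    {c : Choices Ω A S} (hc : c.Valid u v p₀ D (accuracy Ω p₀ D T)) {ρ : Ω → ℝ}
    (hρ : ∀ i, i ≠ c.ref →
      0 ≤ ρ i ∧ |ρ i - μ i / μ c.ref| ≤ 2 * accuracy Ω p₀ D T / p₀ ^ 2) :
    LossBounded u v μ (optUtility S u v μ) T 2
      (fun _ => (c.exploit (priorEstimate c.ref ρ)).embed ι) := by
  have hD0 := hD.1
  have hT1 : (1 : ℝ) ≤ T := by exact_mod_cast hT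
  have hT0 : (0 : ℝ) < T := by linarith
  have hn0 : (0 : ℝ) < Fintype.card Ω := by exact_mod_cast hn
  have hpos : ∀ ω, 0 < μ ω := fun ω => hp₀.trans_le (hμp ω)
  have hε0 : 0 < accuracy Ω p₀ D T := by unfold accuracy; positivity
  have hspec := hc.exploit_spec (priorEstimate c.ref ρ)
  -- The accuracy makes the robustification parameter `e = p₀² D / (7 T)`, so `δ = 2 p₀ / (7 T)`.
  -- The prior is then known to within `e / 3` in `ℓ¹`, where `2 p₀ ≤ 1` is used.
  have hee : 6 * Fintype.card Ω * accuracy Ω p₀ D T / p₀ ^ 3 = p₀ ^ 2 * D / (7 * T) := by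
    unfold accuracy; field_simp; norm_num
  have herr : 2 * (Fintype.card Ω * (2 * accuracy Ω p₀ D T / p₀ ^ 2)) ≤
      p₀ ^ 2 * D / (7 * T) / 3 := by
    have : 2 * (Fintype.card Ω * (2 * accuracy Ω p₀ D T / p₀ ^ 2)) =
        p₀ ^ 2 * D / (7 * T) / 3 * (2 * p₀) := by
      unfold accuracy; field_simp; norm_num
    rw [this]
    exact mul_le_of_le_one_right (by positivity) hp2
  obtain ⟨hν1, hνe⟩ := priorEstimate_sum_and_error hpos hμ.2 (by positivity)
    (fun i hi => (hρ i hi).1) (fun i hi => (hρ i hi).2)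
  rw [hee] at hspec
  set ν := priorEstimate c.ref ρ with hν
  set e := p₀ ^ 2 * D / (7 * T) with he
  have he0 : 0 < e := by positivity
  have hep : e ≤ p₀ ^ 2 / 7 := by
    rw [he, div_le_div_iff₀ (by positivity) (by norm_num)]
    nlinarith [mul_le_mul_of_nonneg_left hD1 (sq_nonneg p₀),
      mul_le_mul_of_nonneg_left hT1 (sq_nonneg p₀)]
  have hδe : 2 * e / (p₀ * D) = 2 * p₀ / (7 * T) := by
    rw [he]; field_simp
  have hδ : 2 * e / (p₀ * D) < p₀ := by
    rw [hδe, div_lt_iff₀ (by positivity)]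
    nlinarith [mul_le_mul_of_nonneg_left hT1 hp₀.le]
  have hL1 : ∑ ω, |ν ω - μ ω| ≤ e / 3 := hνe.trans herr
  have hdist : ∀ ω, |ν ω - μ ω| ≤ e / 3 := fun ω =>
    (Finset.single_le_sum (f := fun ω => |ν ω - μ ω|) (fun _ _ => abs_nonneg _)
      (Finset.mem_univ ω)).trans hL1
  have hνp : ∀ ω, p₀ - e / 3 ≤ ν ω := fun ω => by
    linarith [(abs_le.1 (hdist ω)).1, hμp ω]
  have hep' : e ≤ p₀ / 14 := by nlinarith
  have hνpos : ∀ ω, 0 < ν ω := fun ω => by linarith [hνp ω]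
  have hνμ : ∀ ω, |ν ω - μ ω| * p₀ ≤ e * μ ω := fun ω => by
    nlinarith [mul_le_mul_of_nonneg_right (hdist ω) hp₀.le,
      mul_le_mul_of_nonneg_left (hμp ω) he0.le]
  have hμν : ∀ ω, |μ ω - ν ω| * p₀ ≤ e * ν ω := fun ω => by
    rw [abs_sub_comm]
    nlinarith [mul_le_mul_of_nonneg_right (hdist ω) hp₀.le,
      mul_le_mul_of_nonneg_left (hνp ω) he0.le]
  have hp1 : p₀ ≤ 1 := by linarith
  have hrob := hspec (exists_isRobustOptimal u hp₀ hp1 hD he0 hδ.le hν1 fun ω => by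
    nlinarith [mul_le_mul_of_nonneg_left (hνp ω) (show (0 : ℝ) ≤ 1 + p₀ by linarith)])
  have hopt := optUtility_le_of_isRobustOptimal (S := S) hp₀ hp1 hD he0 hδ hu hv hG hμp hμ.2
    hνpos hν1 hνμ (κ := e / 3) (by simpa only [abs_sub_comm] using hL1) hrob
  obtain ⟨π, hπ, hπ'⟩ := hrob
  have hκ : 2 * (2 * e / (p₀ * D) / p₀ + 2 * e / (p₀ * D) + e / 3) ≤ 2 / T := by
    have h1 : 2 * e / (p₀ * D) / p₀ = 2 / 7 * (1 / T) := by rw [hδe]; field_simp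
    have h2 : 2 * e / (p₀ * D) = 2 / 7 * p₀ * (1 / T) := by rw [hδe]; field_simp
    have h3 : e = p₀ ^ 2 * D / 7 * (1 / T) := by rw [he]; field_simp
    have h4 : 2 / (T : ℝ) = 2 * (1 / T) := by ring
    rw [h1, h2, h4]
    have hT' : 0 < 1 / (T : ℝ) := by positivity
    have h5 : e ≤ 1 / 7 * (1 / T) := by
      rw [h3]
      refine mul_le_mul_of_nonneg_right ?_ hT'.le
      have : p₀ ^ 2 * D ≤ 1 := mul_le_one₀ (pow_le_one₀ hp₀.le hp1) hD0.le hD1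
      linarith
    have h6 := mul_le_mul_of_nonneg_right hp2 hT'.le
    linarith
  refine lossBounded_const hμ (κ := 2 / T) (by positivity) (by field_simp; rfl) fun α hα => ?_
  rw [hπ'.utility_embed ι u hp₀ hp1 hD0 he0 hδ hv hG hνpos hpos hμν hπ.1 hα]
  linarith

theorem regret_learnAndRobustify_le (ι : A ↪ S) {u v : A → Ω → ℝ}
    (hu : ∀ a ω, u a ω ∈ Set.Icc (0 : ℝ) 1) (hv : ∀ a ω, v a ω ∈ Set.Icc (0 : ℝ) 1)
    {μ : Ω → ℝ} (hμ : μ ∈ stdSimplex ℝ Ω) {p₀ : ℝ} (hp₀ : 0 < p₀)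
    (hμp : ∀ ω, p₀ ≤ μ ω) {G : ℝ} (hG : HasUniqueOptimalActions v G) {D : ℝ}
    (hD : IsDominanceMargin v D) {T : ℕ} (hT : 1 ≤ T)
    {c : Choices Ω A S} (hc : c.Valid u v p₀ D (accuracy Ω p₀ D T)) {N : ℕ}
    (hN : 42 * Fintype.card Ω * T / (G ^ 2 * p₀ ^ 6 * D) ≤ 2 ^ N)
    {R : Behavior Ω A S} (hR : IsOptimalBehavior v μ R) :
    regret u v μ T (learnAndRobustify ι v p₀ G (accuracy Ω p₀ D T) c) R ≤
      (2 * Fintype.card Ω - 3) * (N / p₀) + 2 := by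
  have := hc.dist.nontrivial
  have hp2 := hc.dist.two_mul_le_one hμ hμp
  have hn : 0 < Fintype.card Ω := by have := hc.dist.two_le_card; omega
  have hD1 := hD.le_one hv
  have hD0 := hD.1
  have hG0 := hG.1
  have hT1 : (1 : ℝ) ≤ T := by exact_mod_cast hT
  have hT0 : (0 : ℝ) < T := by linarith
  have hn1 : (1 : ℝ) ≤ Fintype.card Ω := by exact_mod_cast hn
  have hn0 : (0 : ℝ) < Fintype.card Ω := by linarith
  have hε0 : 0 < accuracy Ω p₀ D T := by unfold accuracy; positivity
  have hεp : 2 * accuracy Ω p₀ D T ≤ p₀ := by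
    have h1 : p₀ ^ 4 * D ≤ 1 := mul_le_one₀ (pow_le_one₀ hp₀.le (by linarith)) hD0.le hD1
    have h2 : 1 ≤ (Fintype.card Ω : ℝ) * T := one_le_mul_of_one_le_of_one_le hn1 hT1
    unfold accuracy
    rw [mul_div_assoc', div_le_iff₀ (by positivity)]
    nlinarith [mul_le_mul_of_nonneg_left h1 hp₀.le, mul_le_mul_of_nonneg_left h2 hp₀.le]
  have hN' : 1 / (G * p₀) ≤ accuracy Ω p₀ D T * G * 2 ^ N := by
    -- The argument of the logarithm is the initial interval length divided by the final one, `ε G`.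
    have h1 : 1 / (G * p₀) = accuracy Ω p₀ D T * G *
        (42 * Fintype.card Ω * T / (G ^ 2 * p₀ ^ 6 * D)) := by
      unfold accuracy; field_simp
    rw [h1]
    exact mul_le_mul_of_nonneg_left hN (by positivity)
  have hloss := lossBounded_estimateAll hu hv hμ hp₀ hμp hG hε0 hεp hc
    (optUtility_le_one (S := S) (v := v) hu hμ) zero_le_two hN' (T := T)
    (k := fun ρ _ => (c.exploit (priorEstimate c.ref ρ)).embed ι)
    (fun ρ hρ => lossBounded_exploit ι hu hv hμ hp₀ hp2 hμp hG hD hD1 hT hn hc hρ)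
    c.others (fun _ => 0) (fun i hi hi' => by
      rcases List.mem_cons.1 (hc.complete i) with h | h
      · exact absurd h hi
      · exact absurd h hi')
  refine (hloss T le_rfl R hR).trans ?_
  have hcount : (((c.others.map fun i => numSearches v i c.ref).sum : ℕ) : ℝ) + 3 ≤
      2 * Fintype.card Ω := by exact_mod_cast sum_numSearches_add_three_le hc
  have hN0 : 0 ≤ (N : ℝ) / p₀ := by positivity
  nlinarith [mul_le_mul_of_nonneg_right hcount hN0]

end Regret
end Persuasion
end

/-! ### The theorem. -/

open Persuasion in
theorem theorem1 {Ω A S : Type*} [Fintype Ω] [Fintype A] [Fintype S]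
    [DecidableEq Ω] [DecidableEq A] [DecidableEq S] [Nonempty A] (ι : A ↪ S)
    (u v : A → Ω → ℝ) (hu : ∀ a ω, u a ω ∈ Set.Icc (0 : ℝ) 1)
    (hv : ∀ a ω, v a ω ∈ Set.Icc (0 : ℝ) 1)
    (μ : Ω → ℝ) (hμ : μ ∈ stdSimplex ℝ Ω)
    (p₀ : ℝ) (hp₀ : 0 < p₀) (hμp₀ : ∀ ω, p₀ ≤ μ ω)
    (hdom : Persuasion.NoWeaklyDominatedAction v)
    (G : ℝ) (hG : Persuasion.HasUniqueOptimalActions v G)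
    (hdist : ∃ ω ω' : Ω, Persuasion.Distinguishable v ω ω') :
    (∃ D : ℝ, Persuasion.IsDominanceMargin v D) ∧
    ∀ D : ℝ, Persuasion.IsDominanceMargin v D →
      (∀ T : ℕ, 1 ≤ T → ∀ c : Persuasion.Choices Ω A S,
        c.Valid u v p₀ D (Persuasion.accuracy Ω p₀ D T) →
        ∀ R : Persuasion.Behavior Ω A S, Persuasion.IsOptimalBehavior v μ R →
          Persuasion.regret u v μ T
              (Persuasion.learnAndRobustify ι v p₀ G (Persuasion.accuracy Ω p₀ D T) c) R
            ≤ 2 * Fintype.card Ω / p₀ * ⌈Persuasion.logTerm Ω p₀ G D T⌉ + 2 ∧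
          (2 * (Fintype.card Ω : ℝ) - 3 ≤ 3 * Persuasion.logTerm Ω p₀ G D T →
            Persuasion.regret u v μ T
                (Persuasion.learnAndRobustify ι v p₀ G (Persuasion.accuracy Ω p₀ D T) c) R
              ≤ 2 * Fintype.card Ω / p₀ * Persuasion.logTerm Ω p₀ G D T + 2)) ∧
      ∃ C : ℝ, ∀ T : ℕ, 2 ≤ T → ∀ c : Persuasion.Choices Ω A S,
        c.Valid u v p₀ D (Persuasion.accuracy Ω p₀ D T) →
        ∀ R : Persuasion.Behavior Ω A S, Persuasion.IsOptimalBehavior v μ R →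
          Persuasion.regret u v μ T
              (Persuasion.learnAndRobustify ι v p₀ G (Persuasion.accuracy Ω p₀ D T) c) R
            ≤ C * Real.log T := by
  obtain ⟨ω₁, ω₂, hd⟩ := hdist
  have := hd.nontrivial
  refine ⟨exists_dominanceMargin hdom, fun D hD => ?_⟩
  have hG0 := hG.1
  have hD0 := hD.1
  have hD1 := hD.le_one hv
  have hG1 := hG.lt_one hv hd
  have hp2 := hd.two_mul_le_one hμ hμp₀
  have hn2 : (2 : ℝ) ≤ Fintype.card Ω := by exact_mod_cast hd.two_le_card
  have hn0 : (0 : ℝ) < Fintype.card Ω := by linarith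
  have hden : G ^ 2 * p₀ ^ 6 * D ≤ 1 :=
    mul_le_one₀ (mul_le_one₀ (pow_le_one₀ hG0.le hG1.le) (by positivity)
      (pow_le_one₀ hp₀.le (by linarith))) hD0.le hD1
  -- Nonnegativity makes the natural and the integer ceiling agree.
  have hlog : ∀ T : ℕ, 1 ≤ T → 0 ≤ logTerm Ω p₀ G D T := fun T hT => by
    have hT1 : (1 : ℝ) ≤ T := by exact_mod_cast hT
    refine Real.logb_nonneg one_lt_two ?_
    rw [one_le_div (by positivity)]
    nlinarith
  have main : ∀ T : ℕ, 1 ≤ T → ∀ c : Choices Ω A S, c.Valid u v p₀ D (accuracy Ω p₀ D T) →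
      ∀ R : Behavior Ω A S, IsOptimalBehavior v μ R →
      regret u v μ T (learnAndRobustify ι v p₀ G (accuracy Ω p₀ D T) c) R ≤
        (2 * Fintype.card Ω - 3) * (⌈logTerm Ω p₀ G D T⌉ / p₀) + 2 := by
    intro T hT c hc R hR
    have hT0 : (0 : ℝ) < T := by exact_mod_cast hT
    have hcast : (⌈logTerm Ω p₀ G D T⌉₊ : ℝ) = ⌈logTerm Ω p₀ G D T⌉ :=
      natCast_ceil_eq_intCast_ceil (hlog T hT)
    rw [← hcast]
    refine regret_learnAndRobustify_le ι hu hv hμ hp₀ hμp₀ hG hD hT hc ?_ hR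
    rw [← Real.rpow_natCast 2 ⌈_⌉₊, ← Real.logb_le_iff_le_rpow one_lt_two (by positivity)]
    exact Nat.le_ceil _
  have hceil : ∀ T : ℕ, 1 ≤ T → ∀ c : Choices Ω A S, c.Valid u v p₀ D (accuracy Ω p₀ D T) →
      ∀ R : Behavior Ω A S, IsOptimalBehavior v μ R →
      regret u v μ T (learnAndRobustify ι v p₀ G (accuracy Ω p₀ D T) c) R ≤
        2 * Fintype.card Ω / p₀ * ⌈logTerm Ω p₀ G D T⌉ + 2 := by
    intro T hT c hc R hR
    refine (main T hT c hc R hR).trans ?_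
    have h1 : 0 ≤ (⌈logTerm Ω p₀ G D T⌉ : ℝ) / p₀ :=
      div_nonneg ((hlog T hT).trans (Int.le_ceil _)) hp₀.le
    have h2 : 2 * (Fintype.card Ω : ℝ) / p₀ * ⌈logTerm Ω p₀ G D T⌉ =
        2 * Fintype.card Ω * (⌈logTerm Ω p₀ G D T⌉ / p₀) := by ring
    rw [h2]
    linarith
  refine ⟨fun T hT c hc R hR => ⟨hceil T hT c hc R hR, fun hL => ?_⟩, ?_⟩
  · refine (main T hT c hc R hR).trans ?_
    have h1 := (Int.ceil_lt_add_one (logTerm Ω p₀ G D T)).le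
    rw [mul_div_assoc', div_mul_eq_mul_div]
    gcongr ?_ / _ + 2
    -- The three searches saved absorb the rounding: `(2|Ω| - 3)(L + 1) ≤ 2|Ω| L` holds exactly when
    -- `2|Ω| - 3 ≤ 3 L`.
    nlinarith [mul_le_mul_of_nonneg_left h1 (show (0 : ℝ) ≤ 2 * Fintype.card Ω - 3 by linarith)]
  · set K : ℝ := 42 * Fintype.card Ω / (G ^ 2 * p₀ ^ 6 * D) with hK
    set M : ℝ := 2 * Fintype.card Ω / p₀ with hM
    have hK0 : 0 < K := by positivity
    have hM0 : 0 < M := by positivity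
    have hl2 : 0 < Real.log 2 := Real.log_pos one_lt_two
    -- For `T ≥ 2` a constant `x ≥ 0` is at most `x / log 2 * log T`, so the additive terms are
    -- absorbed.
    refine ⟨M / Real.log 2 + (M * (|Real.logb 2 K| + 1) + 2) / Real.log 2,
      fun T hT c hc R hR => (hceil T (by omega) c hc R hR).trans ?_⟩
    have hT2 : (2 : ℝ) ≤ T := by exact_mod_cast hT
    have hL : logTerm Ω p₀ G D T = Real.logb 2 K + Real.log T / Real.log 2 := by
      rw [Real.log_div_log, ← Real.logb_mul hK0.ne' (by positivity), logTerm, hK]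
      congr 1
      ring
    have hlT : Real.log 2 ≤ Real.log T := Real.log_le_log two_pos hT2
    have h1 := (Int.ceil_lt_add_one (logTerm Ω p₀ G D T)).le
    have h2 : (⌈logTerm Ω p₀ G D T⌉ : ℝ) ≤
        (|Real.logb 2 K| + 1) + Real.log T / Real.log 2 := by
      linarith [le_abs_self (Real.logb 2 K)]
    have h3 := mul_le_mul_of_nonneg_left h2 hM0.le
    have h4 : M * (|Real.logb 2 K| + 1) + 2 ≤
        (M * (|Real.logb 2 K| + 1) + 2) / Real.log 2 * Real.log T := by
      rw [div_mul_eq_mul_div _ (Real.log 2), le_div_iff₀ hl2]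
      exact mul_le_mul_of_nonneg_left hlT (by positivity)
    calc M * ⌈logTerm Ω p₀ G D T⌉ + 2
        ≤ M / Real.log 2 * Real.log T + (M * (|Real.logb 2 K| + 1) + 2) := by
          have : M * (Real.log T / Real.log 2) = M / Real.log 2 * Real.log T := by ring
          linarith
      _ ≤ _ := by rw [add_mul]; linarith
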